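/- Let $M$ be an $n$-dimensional (Hausdorff) manifold of class $C^{2,1}$, i.e. with coordinate changes that are $C^2$ with locally Lipschitz second derivatives; "chart" means a chart of its maximal $C^{2,1}$ atlas. Let $M$ be endowed with a locally Lipschitz spray: in every chart $\{x^\mu\}$ a function $H^\mu(x,v)$, locally Lipschitz in $(x,v)$, with $H^\mu(x,sv)=s^2H^\mu(x,v)$ for all $s>0$, such that the equations $\dot x^\mu=v^\mu$, $\dot v^\mu=H^\mu(x,v)$ transform into each other under changes of chart. The reverse spray is $H^\mu(x,-v)$. Let $\pi\colon TM\to M$ be the tangent bundle and, for $v\in TM$, let $\gamma_v$ be the solution with $\gamma_v(0)=\pi(v)$, $\dot\gamma_v(0)=v$. A geodesic is a non-stationary solution. Let $\exp v=(\pi(v),\gamma_v(1))$ and $\exp_q v=\gamma_v(1)$ for $v\in T_qM$, on the sets $\Omega\subset TM$ and $\Omega_q\subset T_qM$ of those $v$ for which $\gamma_v$ exists on $[0,1]$, and let $\widetilde{\exp}\,v=(\pi(v),\gamma_v(-1))$, on the set of those $v\in TM$ for which $\gamma_v$ exists on $[-1,0]$ (the exponential map of the reverse spray, up to the sign of $v$).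 A Lipeomorphism is a bijection which, together with its inverse, is continuous and locally Lipschitz (in charts). A subset of $TM$ or of $T_qM$ is star-shaped if with $v$ it contains $sv$ for all $s\in[0,1]$. An open set $C\subset M$ is convex normal if for every $q\in C$ there is an open star-shaped subset of $\Omega_q$ that $\exp_q$ maps Lipeomorphically onto $C$; it is strictly convex normal if moreover any two distinct points of $\bar C$ are connected by a unique geodesic (parametrized by $[0,1]$) contained in $C$ but for the endpoints; it is reversible strictly convex normal if it is strictly convex normal both for the spray and for the reverse spray. **Theorem.** Let $p\in M$ and let $O$ be an open neighbourhood of $p$. Then there is a reversible strictly convex normal neighbourhood $C$ of $p$, contained in $O$, such that $\exp$ establishes a Lipeomorphism between an open star-shaped subset of $TC$ and $C\times C$, and such that $\widetilde{\exp}$ establishes a Lipeomorphism between an open star-shaped subset of $TC$ and $C\times C$. Moreover, for every chart defined in a neighbourhood of $p$ there is $\delta_0>0$ such that for every $0<\delta<\delta_0$ the open coordinate ball of radius $\delta$ centred at $p$ (defined through the Euclidean norm of the coordinates) is contained in the domain of the chart and can be chosen as $C$. -/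

import Mathlib

open Set Filter Topology
open scoped Manifold ContDiff NNReal

noncomputable section

/-- `f` is of class `C^{2,1}` (locally) on the open set `s`: it is `C^2` and its second
differential is locally Lipschitz. -/
def C21On {E F : Type*} [NormedAddCommGroup E] [NormedSpace ℝ E]
    [NormedAddCommGroup F] [NormedSpace ℝ F] (f : E → F) (s : Set E) : Prop :=
  ContDiffOn ℝ 2 f s ∧ LocallyLipschitzOn s (fderiv ℝ (fderiv ℝ f))

/-- An `n`-dimensional manifold (without boundary) of class `C^{2,1}`: all the coordinate changes
of the atlas are of class `C^{2,1}`. -/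
class IsC21Manifold (n : ℕ) (M : Type*) [TopologicalSpace M]
    [ChartedSpace (EuclideanSpace ℝ (Fin n)) M] : Prop extends IsManifold (𝓡 n) 2 M where
  c21 : ∀ e ∈ atlas (EuclideanSpace ℝ (Fin n)) M, ∀ e' ∈ atlas (EuclideanSpace ℝ (Fin n)) M,
    C21On (e.symm ≫ₕ e') (e.symm ≫ₕ e').source

/-- The charts of a `C^{2,1}` manifold: the maximal `C^{2,1}` atlas. -/
def c21Charts (n : ℕ) (M : Type*) [TopologicalSpace M]
    [ChartedSpace (EuclideanSpace ℝ (Fin n)) M] :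
    Set (OpenPartialHomeomorph M (EuclideanSpace ℝ (Fin n))) :=
  {e | ∀ e' ∈ atlas (EuclideanSpace ℝ (Fin n)) M,
    C21On (e.symm ≫ₕ e') (e.symm ≫ₕ e').source ∧ C21On (e'.symm ≫ₕ e) (e'.symm ≫ₕ e).source}

/-- `f : X → Y` is locally Lipschitz on `A`, for manifolds `X`, `Y`: it is continuous and near
each point of `A` it is Lipschitz when read in charts (as in Mathlib's `ContMDiffOn`, the
preferred charts at the point and at its image are used). -/
def LocLipOn {E H X E' H' Y : Type*}
    [NormedAddCommGroup E] [NormedSpace ℝ E] [TopologicalSpace H] (I : ModelWithCorners ℝ E H)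
    [TopologicalSpace X] [ChartedSpace H X]
    [NormedAddCommGroup E'] [NormedSpace ℝ E'] [TopologicalSpace H'] (I' : ModelWithCorners ℝ E' H')
    [TopologicalSpace Y] [ChartedSpace H' Y] (f : X → Y) (A : Set X) : Prop :=
  ∀ x ∈ A, ContinuousWithinAt f A x ∧
    ∃ K : ℝ≥0, ∃ t ∈ 𝓝[A] x, ∀ y ∈ t, ∀ z ∈ t,
      ‖extChartAt I' (f x) (f y) - extChartAt I' (f x) (f z)‖
        ≤ K * ‖extChartAt I x y - extChartAt I x z‖

/-- `f` restricts to a Lipeomorphism of `A` onto `B`: a bijection which, together with its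
inverse, is (continuous and) locally Lipschitz. -/
def IsLipeoOn {E H X E' H' Y : Type*}
    [NormedAddCommGroup E] [NormedSpace ℝ E] [TopologicalSpace H] (I : ModelWithCorners ℝ E H)
    [TopologicalSpace X] [ChartedSpace H X]
    [NormedAddCommGroup E'] [NormedSpace ℝ E'] [TopologicalSpace H'] (I' : ModelWithCorners ℝ E' H')
    [TopologicalSpace Y] [ChartedSpace H' Y] (f : X → Y) (A : Set X) (B : Set Y) : Prop :=
  MapsTo f A B ∧ LocLipOn I I' f A ∧
    ∃ g : Y → X, MapsTo g B A ∧ InvOn g f A B ∧ LocLipOn I' I g B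

/-- A locally Lipschitz spray on a `C^{2,1}` manifold, given in every chart `e` by the right-hand
side `H e` of the second order equation `x' = v`, `v' = H e x v`. -/
structure LipschitzSpray (n : ℕ) (M : Type*) [TopologicalSpace M]
    [ChartedSpace (EuclideanSpace ℝ (Fin n)) M] where
  H : OpenPartialHomeomorph M (EuclideanSpace ℝ (Fin n)) →
    EuclideanSpace ℝ (Fin n) → EuclideanSpace ℝ (Fin n) → EuclideanSpace ℝ (Fin n)
  /-- local Lipschitz continuity in position and velocity -/
  locallyLipschitz : ∀ e ∈ c21Charts n M,
    LocallyLipschitzOn (e.target ×ˢ univ) (fun z => H e z.1 z.2)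
  /-- positive homogeneity of degree two in the velocity -/
  homogeneous : ∀ e ∈ c21Charts n M, ∀ x ∈ e.target, ∀ v, ∀ s : ℝ, 0 < s →
    H e x (s • v) = s ^ 2 • H e x v
  /-- the transformation law under the coordinate change `e.symm ≫ₕ e'` from `e` to `e'` -/
  transform : ∀ e ∈ c21Charts n M, ∀ e' ∈ c21Charts n M, ∀ x ∈ (e.symm ≫ₕ e').source, ∀ v,
    H e' ((e.symm ≫ₕ e') x) (fderiv ℝ (e.symm ≫ₕ e') x v)
      = fderiv ℝ (fderiv ℝ (e.symm ≫ₕ e')) x v v + fderiv ℝ (e.symm ≫ₕ e') x (H e x v)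

/-- The components of the tangent vector `v` in the chart `e`. -/
def velocityIn {n : ℕ} {M : Type*} [TopologicalSpace M]
    [ChartedSpace (EuclideanSpace ℝ (Fin n)) M]
    (e : OpenPartialHomeomorph M (EuclideanSpace ℝ (Fin n))) (v : TangentBundle (𝓡 n) M) :
    EuclideanSpace ℝ (Fin n) :=
  mfderiv (𝓡 n) (𝓡 n) e v.proj v.2

/-- A subset of the tangent bundle is star-shaped if it is invariant under multiplication by
every `s ∈ [0,1]` in the fibres. -/
def IsStarShaped {n : ℕ} {M : Type*} [TopologicalSpace M]
    [ChartedSpace (EuclideanSpace ℝ (Fin n)) M] (W : Set (TangentBundle (𝓡 n) M)) : Prop :=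
  ∀ v ∈ W, ∀ s ∈ Icc (0 : ℝ) 1, (⟨v.proj, s • v.2⟩ : TangentBundle (𝓡 n) M) ∈ W

namespace LipschitzSpray

variable {n : ℕ} {M : Type*} [TopologicalSpace M] [ChartedSpace (EuclideanSpace ℝ (Fin n)) M]

/-- The reverse spray `(x, v) ↦ H (x, -v)`. -/
def reverse (S : LipschitzSpray n M) : LipschitzSpray n M where
  H e x v := S.H e x (-v)
  locallyLipschitz e he := by
    have hneg : LipschitzWith 1
        (fun z : EuclideanSpace ℝ (Fin n) × EuclideanSpace ℝ (Fin n) => (z.1, -z.2)) := by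
      refine LipschitzWith.of_dist_le_mul fun a b => ?_
      simp [Prod.dist_eq]
    intro z hz
    obtain ⟨K, t, ht, hK⟩ := S.locallyLipschitz e he (x := (z.1, -z.2)) ⟨hz.1, mem_univ _⟩
    refine ⟨K,
      (fun z : EuclideanSpace ℝ (Fin n) × EuclideanSpace ℝ (Fin n) => (z.1, -z.2)) ⁻¹' t, ?_, ?_⟩
    · refine (hneg.continuous.continuousWithinAt.tendsto_nhdsWithin ?_) ht
      exact fun y hy => ⟨hy.1, mem_univ _⟩
    · have h := hK.comp (hneg.lipschitzOnWith
        (s := (fun z : EuclideanSpace ℝ (Fin n) × EuclideanSpace ℝ (Fin n) => (z.1, -z.2)) ⁻¹' t))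
        (fun y hy => hy)
      rwa [mul_one] at h
  homogeneous e he x hx v s hs := by
    rw [← smul_neg]
    exact S.homogeneous e he x hx (-v) s hs
  transform e he e' he' x hx v := by
    have h := S.transform e he e' he' x hx (-v)
    simpa using h

/-- The curve `c` in the tangent bundle solves the first order system `x' = v`, `v' = H(x, v)` of
the spray on the interval `J` (with one-sided derivatives at the endpoints of `J`), in all charts.
Then `c` is the velocity of the curve `π ∘ c` in the manifold. -/
def IsSolutionOn (S : LipschitzSpray n M) (c : ℝ → TangentBundle (𝓡 n) M) (J : Set ℝ) : Prop :=
  ContinuousOn (fun t => (c t).proj) J ∧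
    ∀ e ∈ c21Charts n M, ∀ t ∈ J, (c t).proj ∈ e.source →
      HasDerivWithinAt (fun s => e (c s).proj) (velocityIn e (c t)) J t ∧
      HasDerivWithinAt (fun s => velocityIn e (c s))
        (S.H e (e (c t).proj) (velocityIn e (c t))) J t

/-- (The velocity curve of) a geodesic: a non-stationary solution. -/
def IsGeodesicOn (S : LipschitzSpray n M) (c : ℝ → TangentBundle (𝓡 n) M) (J : Set ℝ) : Prop :=
  S.IsSolutionOn c J ∧ ∀ t ∈ J, (c t).2 ≠ 0

/-- The set of those `v` for which the solution `γ_v` with initial velocity `v` exists between the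
times `0` and `τ`. -/
def domain (S : LipschitzSpray n M) (τ : ℝ) : Set (TangentBundle (𝓡 n) M) :=
  {v | ∃ c : ℝ → TangentBundle (𝓡 n) M, S.IsSolutionOn c (uIcc 0 τ) ∧ c 0 = v}

open Classical in
/-- The point `γ_v(τ)`, for `v` in `S.domain τ` (a junk value elsewhere). -/
def point (S : LipschitzSpray n M) (τ : ℝ) (v : TangentBundle (𝓡 n) M) : M :=
  if h : v ∈ S.domain τ then (h.choose τ).proj else v.proj

/-- The exponential map `v ↦ (π v, γ_v(1))`, meaningful on `Ω = S.domain 1`. -/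
def exp (S : LipschitzSpray n M) (v : TangentBundle (𝓡 n) M) : M × M :=
  (v.proj, S.point 1 v)

/-- The exponential map of the reverse spray, with the convention `v ↦ (π v, γ_v(-1))`,
meaningful on `S.domain (-1)`. -/
def revExp (S : LipschitzSpray n M) (v : TangentBundle (𝓡 n) M) : M × M :=
  (v.proj, S.point (-1) v)

/-- The pointed exponential map `exp_p v = γ_v(1)`; the tangent space at `p` is, by definition, a
copy of `EuclideanSpace ℝ (Fin n)`. -/
def expAt (S : LipschitzSpray n M) (p : M) (v : EuclideanSpace ℝ (Fin n)) : M :=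
  S.point 1 (⟨p, v⟩ : TangentBundle (𝓡 n) M)

/-- `N` is a normal neighbourhood of `p`: an open neighbourhood that is the Lipeomorphic image
under `exp_p` of an open star-shaped subset of `Ω_p`. -/
def IsNormalNhd (S : LipschitzSpray n M) (p : M) (N : Set M) : Prop :=
  IsOpen N ∧ p ∈ N ∧ ∃ V : Set (EuclideanSpace ℝ (Fin n)), IsOpen V ∧ StarConvex ℝ 0 V ∧
    (∀ v ∈ V, (⟨p, v⟩ : TangentBundle (𝓡 n) M) ∈ S.domain 1) ∧
    IsLipeoOn (𝓡 n) (𝓡 n) (S.expAt p) V N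

/-- `C` is open and is a normal neighbourhood of each of its points. -/
def IsConvexNormal (S : LipschitzSpray n M) (C : Set M) : Prop :=
  IsOpen C ∧ ∀ q ∈ C, S.IsNormalNhd q C

/-- `c` is a geodesic `[0,1] → M` from `q` to `r` contained in `C` but for the endpoints. -/
def Connects (S : LipschitzSpray n M) (C : Set M) (q r : M)
    (c : ℝ → TangentBundle (𝓡 n) M) : Prop :=
  S.IsGeodesicOn c (Icc 0 1) ∧ (c 0).proj = q ∧ (c 1).proj = r ∧
    ∀ t ∈ Ioo (0 : ℝ) 1, (c t).proj ∈ C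

/-- `C` is convex normal and any two (distinct) points of its closure are connected by a unique
geodesic contained in `C` but for the endpoints. -/
def IsStrictlyConvexNormal (S : LipschitzSpray n M) (C : Set M) : Prop :=
  S.IsConvexNormal C ∧ ∀ q ∈ closure C, ∀ r ∈ closure C, q ≠ r →
    ∃ c, S.Connects C q r c ∧ ∀ c', S.Connects C q r c' → EqOn c' c (Icc 0 1)

/-- Strictly convex normal both for the spray and for the reverse spray. -/
def IsReversibleStrictlyConvexNormal (S : LipschitzSpray n M) (C : Set M) : Prop :=
  S.IsStrictlyConvexNormal C ∧ S.reverse.IsStrictlyConvexNormal C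

/-- `exp` establishes a Lipeomorphism between an open star-shaped subset `W` of `TC` (contained in
the domain `Ω`) and `C × C`. -/
def ExpIsLipeo [IsC21Manifold n M] (S : LipschitzSpray n M) (C : Set M) : Prop :=
  ∃ W : Set (TangentBundle (𝓡 n) M), IsOpen W ∧ IsStarShaped W ∧ (∀ v ∈ W, v.proj ∈ C) ∧
    W ⊆ S.domain 1 ∧ IsLipeoOn (𝓡 n).tangent ((𝓡 n).prod (𝓡 n)) S.exp W (C ×ˢ C)

/-- The same for the exponential map of the reverse spray. -/
def RevExpIsLipeo [IsC21Manifold n M] (S : LipschitzSpray n M) (C : Set M) : Prop :=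
  ∃ W : Set (TangentBundle (𝓡 n) M), IsOpen W ∧ IsStarShaped W ∧ (∀ v ∈ W, v.proj ∈ C) ∧
    W ⊆ S.domain (-1) ∧ IsLipeoOn (𝓡 n).tangent ((𝓡 n).prod (𝓡 n)) S.revExp W (C ×ˢ C)

end LipschitzSpray

end

/-! In a chart around `p`, homogeneity of degree two turns a single local Lipschitz bound for `H`
near zero velocity into a scale invariant one: on velocities of norm at most `ρ` the constants are
`K ρ²` in position and `K ρ` in velocity (`exists_of_lipschitzOnWith`). Hence slow geodesics are
nearly affine. By Grönwall, `(q, w) ↦ X q w 1` differs from `(q, w) ↦ q + w` by a map with Lipschitz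
constant 1/2 (`norm_sub_sub_le`), so no derivative of the exponential map is needed. The inverse
function theorem for Lipschitz perturbations of the identity gives surjectivity, and absorbing the
error gives the bi-Lipschitz bounds.

Convexity comes from `‖x - p‖²` along a solution: its second derivative `2(‖v‖² + ⟨x - p, H⟩)` is at
least `‖v‖²`, because `‖H‖ ≤ K‖v‖²` and the ball is small (`half_norm_sq_le`). A geodesic with
endpoints in a closed ball centred at `p` therefore has its interior in the open one. The same fact
makes the domains of the exponential maps star-shaped. For uniqueness, a solution confined to a
small ball for unit time must start slowly (`norm_velocity_le_of_forall_mem_closedBall`), so that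
every competitor lies where the exponential map is injective.

`IsExpFlow` collects these facts; from it everything is carried to the manifold. The coordinate maps
of `M` and `TM` are locally bi-Lipschitz to the preferred charts (`IsLipCoord`), and solutions on
`M` are globally unique (`IsSolutionOn.eqOn`). The reverse spray satisfies the same hypotheses, and
its flow is the time reversal. -/

/-- The pair `(x, v)` solves the first order system `x' = v`, `v' = H x v` on `J`. -/
def SolvesOn {E : Type*} [NormedAddCommGroup E] [NormedSpace ℝ E] (H : E → E → E)
    (x v : ℝ → E) (J : Set ℝ) : Prop :=
  ∀ t ∈ J, HasDerivWithinAt x (v t) J t ∧ HasDerivWithinAt v (H (x t) (v t)) J t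

/-- `H` is positively homogeneous of degree two in the second variable and satisfies the
corresponding scale invariant Lipschitz estimate with constant `K` on the ball of radius `R`. -/
structure IsSprayOnBall {E : Type*} [NormedAddCommGroup E] [NormedSpace ℝ E] (H : E → E → E)
    (p : E) (R K : ℝ) : Prop where
  radius_pos : 0 < R
  const_pos : 0 < K
  homogeneous : ∀ x ∈ Metric.ball p R, ∀ v, ∀ s : ℝ, 0 < s → H x (s • v) = s ^ 2 • H x v
  lipschitz : ∀ ρ : ℝ, ∀ x ∈ Metric.ball p R, ∀ y ∈ Metric.ball p R, ∀ v w : E,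
    ‖v‖ ≤ ρ → ‖w‖ ≤ ρ → ‖H x v - H y w‖ ≤ K * (ρ ^ 2 * ‖x - y‖ + ρ * ‖v - w‖)

namespace SolvesOn

variable {E : Type*} [NormedAddCommGroup E] [NormedSpace ℝ E] {H : E → E → E} {x v : ℝ → E}
  {J : Set ℝ}

theorem mono {J' : Set ℝ} (h : SolvesOn H x v J) (hJ : J' ⊆ J) : SolvesOn H x v J' :=
  fun t ht => ⟨(h t (hJ ht)).1.mono hJ, (h t (hJ ht)).2.mono hJ⟩

theorem continuousOn_fst (h : SolvesOn H x v J) : ContinuousOn x J :=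
  fun t ht => (h t ht).1.continuousWithinAt

theorem continuousOn_snd (h : SolvesOn H x v J) : ContinuousOn v J :=
  fun t ht => (h t ht).2.continuousWithinAt

theorem right_fst {a b t : ℝ} (h : SolvesOn H x v (Icc a b)) (ht : t ∈ Ico a b) :
    HasDerivWithinAt x (v t) (Ici t) t :=
  (h t (Ico_subset_Icc_self ht)).1.mono_of_mem_nhdsWithin (Icc_mem_nhdsGE_of_mem ht)

theorem right_snd {a b t : ℝ} (h : SolvesOn H x v (Icc a b)) (ht : t ∈ Ico a b) :
    HasDerivWithinAt v (H (x t) (v t)) (Ici t) t :=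
  (h t (Ico_subset_Icc_self ht)).2.mono_of_mem_nhdsWithin (Icc_mem_nhdsGE_of_mem ht)

/-- Homogeneity is asked only along the curve and for the given `s`, so that `s = 0` is allowed. The
factor 1/2 prolongs solutions from time 1/2 to time 1, and `s ∈ [0,1]` gives star-shapedness. -/
theorem rescale {J' : Set ℝ} {s : ℝ} (h : SolvesOn H x v J)
    (hH : ∀ t ∈ J, ∀ w, H (x t) (s • w) = s ^ 2 • H (x t) w) (hs : MapsTo (s * ·) J' J) :
    SolvesOn H (fun t => x (s * t)) (fun t => s • v (s * t)) J' := by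
  intro t ht
  have hd : HasDerivWithinAt (fun t : ℝ => s * t) s J' t := by
    simpa using (hasDerivWithinAt_id t J').const_mul s
  have h1 := h _ (hs ht)
  refine ⟨h1.1.scomp t hd hs, ?_⟩
  have h2 := (h1.2.scomp t hd hs).const_smul s
  rw [hH _ (hs ht), pow_two, mul_smul]
  exact h2

end SolvesOn

/-! ### A priori estimates and existence in a normed space -/

namespace IsSprayOnBall

variable {E : Type*} [NormedAddCommGroup E] [NormedSpace ℝ E] {H : E → E → E} {p : E} {R K : ℝ}

theorem apply_zero (hH : IsSprayOnBall H p R K) {x : E} (hx : x ∈ Metric.ball p R) :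
    H x 0 = 0 := by
  have h := hH.lipschitz 0 x hx x hx 0 0
  have h2 := hH.homogeneous x hx 0 2 (by norm_num)
  rw [smul_zero] at h2
  -- Homogeneity with `s = 2` at zero velocity reads `H x 0 = 4 H x 0`.
  have h3 : (3 : ℝ) • H x 0 = 0 := by
    have : (3 : ℝ) • H x 0 = (2 : ℝ) ^ 2 • H x 0 - H x 0 := by
      rw [show (3 : ℝ) = 2 ^ 2 - 1 by norm_num, sub_smul, one_smul]
    rw [this, ← h2, sub_self]
  exact (smul_eq_zero.1 h3).resolve_left (by norm_num)

theorem norm_le (hH : IsSprayOnBall H p R K) {x : E} (hx : x ∈ Metric.ball p R) {v : E} {ρ : ℝ}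
    (hv : ‖v‖ ≤ ρ) : ‖H x v‖ ≤ K * ρ ^ 2 := by
  have hρ : 0 ≤ ρ := (norm_nonneg v).trans hv
  have h := hH.lipschitz ρ x hx x hx v 0 hv (by simpa using hρ)
  rw [hH.apply_zero hx, sub_zero, sub_self, norm_zero, mul_zero, zero_add, sub_zero] at h
  refine h.trans ?_
  have hK := hH.const_pos
  nlinarith [mul_le_mul_of_nonneg_left hv hρ]

theorem homogeneous_of_nonneg (hH : IsSprayOnBall H p R K) {x : E} (hx : x ∈ Metric.ball p R)
    (v : E) {s : ℝ} (hs : 0 ≤ s) : H x (s • v) = s ^ 2 • H x v := by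
  rcases hs.eq_or_lt with rfl | hs
  · simp [hH.apply_zero hx]
  · exact hH.homogeneous x hx v s hs

theorem reverse (hH : IsSprayOnBall H p R K) : IsSprayOnBall (fun x v => H x (-v)) p R K where
  radius_pos := hH.radius_pos
  const_pos := hH.const_pos
  homogeneous x hx v s hs := by
    rw [← smul_neg]; exact hH.homogeneous x hx _ s hs
  lipschitz ρ x hx y hy v w hv hw := by
    have h := hH.lipschitz ρ x hx y hy (-v) (-w) (by simpa using hv) (by simpa using hw)
    rwa [neg_sub_neg, norm_sub_rev w v] at h

theorem mono_radius (hH : IsSprayOnBall H p R K) {R' : ℝ} (h0 : 0 < R') (hR : R' ≤ R) :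
    IsSprayOnBall H p R' K where
  radius_pos := h0
  const_pos := hH.const_pos
  homogeneous x hx := hH.homogeneous x (Metric.ball_subset_ball hR hx)
  lipschitz ρ x hx y hy := hH.lipschitz ρ x (Metric.ball_subset_ball hR hx) y
    (Metric.ball_subset_ball hR hy)

/-- A locally Lipschitz homogeneous function satisfies the scale invariant Lipschitz estimate. -/
theorem exists_of_lipschitzOnWith {U : Set E} (hU : U ∈ 𝓝 p)
    (hom : ∀ x ∈ U, ∀ v, ∀ s : ℝ, 0 < s → H x (s • v) = s ^ 2 • H x v)
    {k : ℝ≥0} {t : Set (E × E)} (ht : t ∈ 𝓝 (p, (0 : E)))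
    (hlip : LipschitzOnWith k (fun z : E × E => H z.1 z.2) t) :
    ∃ R K, Metric.ball p R ⊆ U ∧ IsSprayOnBall H p R K := by
  obtain ⟨r, hr, hrt⟩ := Metric.mem_nhds_iff.1 ht
  obtain ⟨r', hr', hrU⟩ := Metric.mem_nhds_iff.1 hU
  have hmin : 0 < min r r' := lt_min hr hr'
  have hbU : Metric.ball p (min r r') ⊆ U :=
    (Metric.ball_subset_ball (min_le_right _ _)).trans hrU
  set b : ℝ := r / 2 with hb
  have hb0 : 0 < b := by positivity
  have hzero : ∀ x ∈ U, H x 0 = 0 := fun x hx => by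
    have h2 := hom x hx 0 2 (by norm_num)
    rw [smul_zero] at h2
    have h3 : (3 : ℝ) • H x 0 = 0 := by
      have : (3 : ℝ) • H x 0 = (2 : ℝ) ^ 2 • H x 0 - H x 0 := by
        rw [show (3 : ℝ) = 2 ^ 2 - 1 by norm_num, sub_smul, one_smul]
      rw [this, ← h2, sub_self]
    exact (smul_eq_zero.1 h3).resolve_left (by norm_num)
  -- The summand 1 keeps `K` positive when `k = 0`.
  set K : ℝ := (k + 1) * ((b⁻¹) ^ 2 + b⁻¹) with hK
  have hK0 : 0 < K := by positivity
  refine ⟨min r r', K, hbU, hmin, hK0, fun x hx => hom x (hbU hx), ?_⟩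
  intro ρ x hx y hy v w hv hw
  rcases ((norm_nonneg v).trans hv).eq_or_lt with h0 | hρ
  · rw [← h0] at hv hw
    rw [norm_le_zero_iff.1 hv, norm_le_zero_iff.1 hw, hzero x (hbU hx), hzero y (hbU hy), ← h0]
    simp
  -- Scaling by `s` brings both velocities to norm at most `b < r`, hence into `t`. Dividing the
  -- estimate there by the factor `s²` from homogeneity leaves the weights `ρ²` and `ρ`.
  set s : ℝ := b / ρ with hs
  have hs0 : 0 < s := by positivity
  have hmem : ∀ z ∈ Metric.ball p (min r r'), ∀ u : E, ‖u‖ ≤ ρ → (z, s • u) ∈ t := by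
    intro z hz u hu
    apply hrt
    rw [Metric.mem_ball, Prod.dist_eq, max_lt_iff]
    refine ⟨(Metric.mem_ball.1 hz).trans_le (min_le_left _ _), ?_⟩
    rw [dist_zero_right, norm_smul, Real.norm_of_nonneg hs0.le]
    calc s * ‖u‖ ≤ s * ρ := by gcongr
      _ = b := by rw [hs]; field_simp
      _ < r := by rw [hb]; linarith
  have h := hlip.dist_le_mul _ (hmem x hx v hv) _ (hmem y hy w hw)
  rw [dist_eq_norm, hom x (hbU hx) v s hs0, hom y (hbU hy) w s hs0, ← smul_sub, norm_smul,
    Prod.dist_eq, dist_eq_norm, dist_eq_norm, ← smul_sub, norm_smul, norm_pow,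
    Real.norm_of_nonneg hs0.le] at h
  have h1 : s ^ 2 * ‖H x v - H y w‖ ≤ k * (‖x - y‖ + s * ‖v - w‖) :=
    h.trans (mul_le_mul_of_nonneg_left
      (max_le_add_of_nonneg (norm_nonneg _) (by positivity)) k.2)
  have h2 : ‖H x v - H y w‖ ≤ k * ((b⁻¹) ^ 2 * (ρ ^ 2 * ‖x - y‖) + b⁻¹ * (ρ * ‖v - w‖)) := by
    have h3 : ‖H x v - H y w‖ ≤ (s ^ 2)⁻¹ * (k * (‖x - y‖ + s * ‖v - w‖)) := by
      rw [le_inv_mul_iff₀ (by positivity)]; exact h1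
    refine h3.trans (le_of_eq ?_)
    rw [hs]; field_simp
  refine h2.trans ?_
  have hA : 0 ≤ ρ ^ 2 * ‖x - y‖ := by positivity
  have hB : 0 ≤ ρ * ‖v - w‖ := by positivity
  have hb' : 0 < b⁻¹ := by positivity
  have hk : (0 : ℝ) ≤ k := k.2
  rw [hK, mul_assoc]
  refine mul_le_mul (by linarith) ?_ (by positivity) (by positivity)
  nlinarith [mul_nonneg (sq_nonneg b⁻¹) hB, mul_nonneg hb'.le hA]

/-- As long as `5 * K * η * T ≤ 1`, a solution of initial speed at most `η` has a velocity close to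
the initial one. -/
theorem norm_velocity_sub_le (hH : IsSprayOnBall H p R K) {x v : ℝ → E} {T η : ℝ}
    (h : SolvesOn H x v (Icc 0 T)) (hx : ∀ t ∈ Icc 0 T, x t ∈ Metric.ball p R) (hη : 0 < η)
    (hv : ‖v 0‖ ≤ η) (hT : 5 * K * η * T ≤ 1) {t : ℝ} (ht : t ∈ Icc 0 T) :
    ‖v t - v 0‖ ≤ 5 * K * η ^ 2 * t := by
  have hK := hH.const_pos
  -- Where the bound is attained the speed is still at most `2η`, so the acceleration is at most
  -- `4Kη²`, strictly below the slope `5Kη²` of the barrier.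
  refine image_norm_le_of_norm_deriv_right_lt_deriv_boundary (f := fun t => v t - v 0)
    (f' := fun t => H (x t) (v t)) (B := fun t => 5 * K * η ^ 2 * t)
    (B' := fun _ => 5 * K * η ^ 2) (h.continuousOn_snd.sub continuousOn_const)
    (fun t ht => (h.right_snd ht).sub_const _) (by simp)
    (fun t => by simpa using (hasDerivAt_id t).const_mul (5 * K * η ^ 2)) ?_ ht
  intro t ht he
  have h1 : ‖v t - v 0‖ ≤ η := by
    rw [he]
    have : 5 * K * η * t ≤ 1 := le_trans (by have := ht.2.le; gcongr) hT
    nlinarith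
  have h2 : ‖v t‖ ≤ 2 * η := by
    have := norm_add_le (v t - v 0) (v 0)
    rw [sub_add_cancel] at this
    linarith
  have h3 := hH.norm_le (hx t (Ico_subset_Icc_self ht)) h2
  nlinarith [mul_pos hK (pow_pos hη 2)]

/-- A solution on `[0,1]` which remains in a small ball has a small initial velocity. -/
theorem norm_velocity_le_of_forall_mem_closedBall (hH : IsSprayOnBall H p R K) {x v : ℝ → E}
    {δ η : ℝ} (h : SolvesOn H x v (Icc 0 1)) (hx : ∀ t ∈ Icc (0 : ℝ) 1, x t ∈ Metric.closedBall p δ)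
    (hη : 0 < η) (hηK : 10 * K * η ≤ 1) (hδ : 4 * δ < η) (hδR : δ < R) : ‖v 0‖ ≤ η := by
  have hK := hH.const_pos
  by_contra! hv
  have hv0 : 0 < ‖v 0‖ := hη.trans hv
  -- `T` is the time needed to travel `η` at the initial speed. Up to then the velocity changes by
  -- at most half of itself, so the displacement is at least `η / 2 > 2δ`, more than the diameter of
  -- the ball permits.
  set T : ℝ := η / ‖v 0‖ with hT
  have hT0 : 0 < T := by positivity
  have hT1 : T ≤ 1 := by rw [hT, div_le_one hv0]; exact hv.le
  have hTv : T * ‖v 0‖ = η := by rw [hT]; field_simp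
  have hsub : Icc 0 T ⊆ Icc 0 1 := Icc_subset_Icc_right hT1
  have hb : ∀ t ∈ Icc (0 : ℝ) T, ‖v t - v 0‖ ≤ ‖v 0‖ / 2 := by
    intro t ht
    refine (hH.norm_velocity_sub_le (h.mono hsub)
      (fun t ht => Metric.closedBall_subset_ball hδR (hx t (hsub ht))) hv0 le_rfl ?_ ht).trans ?_
    · nlinarith
    · have h1 : t * ‖v 0‖ ≤ η := by rw [← hTv]; have := ht.2; gcongr
      have h2 : 5 * K * (t * ‖v 0‖) ≤ 1 / 2 := by nlinarith
      nlinarith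
  have hd : ∀ t ∈ Icc (0 : ℝ) T,
      HasDerivWithinAt (fun t => x t - t • v 0) (v t - v 0) (Icc 0 T) t := fun t ht => by
    have := ((h.mono hsub) t ht).1.sub ((hasDerivWithinAt_id t (Icc 0 T)).smul_const (v 0))
    simpa using! this
  have hm := (convex_Icc 0 T).norm_image_sub_le_of_norm_hasDerivWithin_le hd hb
    (left_mem_Icc.2 hT0.le) (right_mem_Icc.2 hT0.le)
  rw [zero_smul, sub_zero, sub_zero, Real.norm_of_nonneg hT0.le] at hm
  have h0 := hx 0 (by simp)
  have h1 := hx T ⟨hT0.le, hT1⟩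
  have h2 : ‖x T - x 0‖ ≤ 2 * δ := by
    rw [← dist_eq_norm]
    linarith [dist_triangle_right (x T) (x 0) p, Metric.mem_closedBall.1 h0,
      Metric.mem_closedBall.1 h1]
  have h3 : ‖T • v 0‖ ≤ ‖x T - x 0‖ + ‖x T - T • v 0 - x 0‖ := by
    have : T • v 0 = (x T - x 0) - (x T - T • v 0 - x 0) := by abel
    conv_lhs => rw [this]
    exact norm_sub_le _ _
  rw [norm_smul, Real.norm_of_nonneg hT0.le, hTv] at h3
  have h4 : ‖v 0‖ / 2 * T = η / 2 := by rw [← hTv]; ring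
  linarith

/-- Two solutions of small speed behave as the affine ones, up to a small Lipschitz error. -/
theorem norm_sub_sub_le (hH : IsSprayOnBall H p R K) {x v y w : ℝ → E} {ρ ε : ℝ}
    (hx : SolvesOn H x v (Icc 0 1)) (hy : SolvesOn H y w (Icc 0 1))
    (hxR : ∀ t ∈ Icc (0 : ℝ) 1, x t ∈ Metric.ball p R)
    (hyR : ∀ t ∈ Icc (0 : ℝ) 1, y t ∈ Metric.ball p R)
    (hv : ∀ t ∈ Icc (0 : ℝ) 1, ‖v t‖ ≤ ρ) (hw : ∀ t ∈ Icc (0 : ℝ) 1, ‖w t‖ ≤ ρ)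
    (hε : K * (ρ ^ 2 + ρ) ≤ ε) (hε1 : ε ≤ 1) {t : ℝ} (ht : t ∈ Icc (0 : ℝ) 1) :
    ‖x t - y t - (x 0 - y 0) - t • (v 0 - w 0)‖ ≤
      3 * ε * max ‖x 0 - y 0‖ ‖v 0 - w 0‖ := by
  have hK := hH.const_pos
  have hρ : 0 ≤ ρ := (norm_nonneg _).trans (hv 0 (by simp))
  have hε0 : 0 ≤ ε := le_trans (by positivity) hε
  set D := max ‖x 0 - y 0‖ ‖v 0 - w 0‖ with hD
  have hD0 : 0 ≤ D := (norm_nonneg _).trans (le_max_left _ _)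
  have hacc : ∀ t ∈ Icc (0 : ℝ) 1, ‖H (x t) (v t) - H (y t) (w t)‖ ≤
      ε * ‖(x t - y t, v t - w t)‖ := by
    intro t ht
    refine (hH.lipschitz ρ _ (hxR t ht) _ (hyR t ht) _ _ (hv t ht) (hw t ht)).trans ?_
    have h1 : ‖x t - y t‖ ≤ ‖(x t - y t, v t - w t)‖ :=
      norm_fst_le (x t - y t, v t - w t)
    have h2 : ‖v t - w t‖ ≤ ‖(x t - y t, v t - w t)‖ :=
      norm_snd_le (x t - y t, v t - w t)
    calc K * (ρ ^ 2 * ‖x t - y t‖ + ρ * ‖v t - w t‖)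
        ≤ K * (ρ ^ 2 * ‖(x t - y t, v t - w t)‖ + ρ * ‖(x t - y t, v t - w t)‖) := by gcongr
      _ = K * (ρ ^ 2 + ρ) * ‖(x t - y t, v t - w t)‖ := by ring
      _ ≤ _ := by gcongr
  -- Since `ε ≤ 1`, Grönwall applies with constant 1; the factor 3 bounds `exp 1`.
  have hg : ∀ t ∈ Icc (0 : ℝ) 1, ‖(x t - y t, v t - w t)‖ ≤ 3 * D := by
    intro t ht
    have := norm_le_gronwallBound_of_norm_deriv_right_le (f := fun t => (x t - y t, v t - w t))
      (f' := fun t => (v t - w t, H (x t) (v t) - H (y t) (w t))) (δ := D) (K := 1) (ε := 0)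
      ((hx.continuousOn_fst.sub hy.continuousOn_fst).prodMk
        (hx.continuousOn_snd.sub hy.continuousOn_snd))
      (fun t ht => ((hx.right_fst ht).sub (hy.right_fst ht)).prodMk
        ((hx.right_snd ht).sub (hy.right_snd ht))) le_rfl ?_ t ht
    · refine this.trans ?_
      rw [gronwallBound_ε0, sub_zero, one_mul, mul_comm]
      gcongr
      exact (Real.exp_le_exp.2 ht.2).trans (by linarith [Real.exp_one_lt_d9])
    · intro t ht
      have ht' := Ico_subset_Icc_self ht
      rw [add_zero, one_mul, Prod.norm_mk]
      refine max_le (norm_snd_le (x t - y t, v t - w t)) ((hacc t ht').trans ?_)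
      exact mul_le_of_le_one_left (norm_nonneg _) hε1
  -- The accelerations differ by at most `ε · 3D`; two integrations over a time of at most 1 give
  -- the claim.
  have hvel : ∀ t ∈ Icc (0 : ℝ) 1, ‖v t - w t - (v 0 - w 0)‖ ≤ 3 * ε * D := by
    intro t ht
    have := (convex_Icc (0 : ℝ) 1).norm_image_sub_le_of_norm_hasDerivWithin_le
      (f := fun t => v t - w t) (C := 3 * ε * D) (fun t ht => (hx t ht).2.sub (hy t ht).2)
      (fun t ht => (hacc t ht).trans (by nlinarith [mul_le_mul_of_nonneg_left (hg t ht) hε0]))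
      (left_mem_Icc.2 zero_le_one) ht
    refine this.trans (mul_le_of_le_one_right (by positivity) ?_)
    rw [sub_zero, Real.norm_of_nonneg ht.1]; exact ht.2
  have hd : ∀ t ∈ Icc (0 : ℝ) 1, HasDerivWithinAt (fun t => x t - y t - t • (v 0 - w 0))
      (v t - w t - (v 0 - w 0)) (Icc 0 1) t := fun t ht => by
    have := ((hx t ht).1.sub (hy t ht).1).sub
      ((hasDerivWithinAt_id t (Icc (0 : ℝ) 1)).smul_const (v 0 - w 0))
    simpa using! this
  have := (convex_Icc (0 : ℝ) 1).norm_image_sub_le_of_norm_hasDerivWithin_le hd hvel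
      (left_mem_Icc.2 zero_le_one) ht
  rw [zero_smul, sub_zero, sub_zero, Real.norm_of_nonneg ht.1, sub_right_comm] at this
  exact this.trans (mul_le_of_le_one_right (by positivity) ht.2)

/-- Existence of the solutions of small initial velocity. -/
theorem exists_solvesOn [CompleteSpace E] (hH : IsSprayOnBall H p R K) {a : ℝ} (ha : 0 < a)
    (haK : 2 * K * a ≤ 1) {q w : E} (hq : dist q p + a < R) (hw : 2 * ‖w‖ ≤ a) :
    ∃ x v : ℝ → E, SolvesOn H x v (Icc 0 1) ∧ x 0 = q ∧ v 0 = w ∧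
      ∀ t ∈ Icc (0 : ℝ) 1, x t ∈ Metric.ball p R ∧ ‖v t‖ ≤ a := by
  have hK := hH.const_pos
  set F : E × E → E × E := fun z => (z.2, H z.1 z.2) with hF
  -- With velocities up to `2a`, a displacement of `a` allows only time 1/2. So the doubled initial
  -- velocity is solved on `[0, 1/2]`, and the result is rescaled to `[0, 1]`.
  set z₀ : E × E := (q, (2 : ℝ) • w) with hz₀
  have hball : ∀ z ∈ Metric.closedBall z₀ a, z.1 ∈ Metric.ball p R ∧ ‖z.2‖ ≤ 2 * a := by
    intro z hz
    rw [Metric.mem_closedBall, Prod.dist_eq, max_le_iff] at hz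
    constructor
    · rw [Metric.mem_ball]
      linarith [dist_triangle z.1 q p, hz.1]
    · have h1 : ‖z.2‖ ≤ ‖z.2 - (2 : ℝ) • w‖ + ‖(2 : ℝ) • w‖ := by
        simpa using norm_add_le (z.2 - (2 : ℝ) • w) ((2 : ℝ) • w)
      have h2 := hz.2
      rw [dist_eq_norm] at h2
      have h3 : ‖(2 : ℝ) • w‖ = 2 * ‖w‖ := by rw [norm_smul]; norm_num
      simp only [hz₀] at h2
      linarith
  have hF1 : ∀ z ∈ Metric.closedBall z₀ (a.toNNReal : ℝ), ‖F z‖ ≤ ((2 * a).toNNReal : ℝ) := by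
    rw [Real.coe_toNNReal _ ha.le, Real.coe_toNNReal _ (by positivity)]
    intro z hz
    obtain ⟨h1, h2⟩ := hball z hz
    rw [hF, Prod.norm_mk]
    refine max_le h2 ((hH.norm_le h1 h2).trans ?_)
    nlinarith
  have hF2 : LipschitzOnWith (1 + K * ((2 * a) ^ 2 + 2 * a)).toNNReal F
      (Metric.closedBall z₀ (a.toNNReal : ℝ)) := by
    rw [Real.coe_toNNReal _ ha.le]
    refine LipschitzOnWith.of_dist_le_mul fun z hz y hy => ?_
    rw [Real.coe_toNNReal _ (by positivity), dist_eq_norm, dist_eq_norm]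
    obtain ⟨h1, h2⟩ := hball z hz
    obtain ⟨h3, h4⟩ := hball y hy
    have h5 := hH.lipschitz (2 * a) _ h1 _ h3 _ _ h2 h4
    have h6 : ‖z.1 - y.1‖ ≤ ‖z - y‖ := norm_fst_le (z - y)
    have h7 : ‖z.2 - y.2‖ ≤ ‖z - y‖ := norm_snd_le (z - y)
    have h8 : K * ((2 * a) ^ 2 * ‖z.1 - y.1‖ + 2 * a * ‖z.2 - y.2‖) ≤
        K * ((2 * a) ^ 2 * ‖z - y‖ + 2 * a * ‖z - y‖) := by gcongr
    have h9 : 0 ≤ K * ((2 * a) ^ 2 * ‖z - y‖ + 2 * a * ‖z - y‖) := by positivity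
    rw [hF, Prod.mk_sub_mk, Prod.norm_mk]
    exact max_le (by nlinarith [norm_nonneg (z - y)]) (by nlinarith [norm_nonneg (z - y)])
  have hPL : IsPicardLindelof (fun _ => F)
      (⟨0, by constructor <;> norm_num⟩ : Icc (0 : ℝ) (1 / 2)) z₀ a.toNNReal 0
      (2 * a).toNNReal (1 + K * ((2 * a) ^ 2 + 2 * a)).toNNReal := by
    refine .of_time_independent hF1 hF2 ?_
    rw [Real.coe_toNNReal _ ha.le, Real.coe_toNNReal _ (by positivity)]
    norm_num
    linarith
  have hz : z₀ ∈ Metric.closedBall z₀ ((0 : ℝ≥0) : ℝ) := Metric.mem_closedBall_self le_rfl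
  -- The Picard fixed point itself is kept, because its values are known to remain in the closed
  -- ball around `z₀`.
  obtain ⟨α, hα⟩ := ODE.FunSpace.exists_isFixedPt_next hPL hz
  set c := α.compProj with hc
  have hcb : ∀ t, c t ∈ Metric.closedBall z₀ a := fun t => by
    have := α.compProj_mem_closedBall hPL.mul_max_le (t := t)
    rwa [Real.coe_toNNReal _ ha.le] at this
  have hc0 : c 0 = z₀ := by
    have := ODE.FunSpace.compProj_val (α := α)
      (t := ⟨0, by constructor <;> norm_num⟩)
    rw [hc, this, ← hα, ODE.FunSpace.next_apply₀]
  have hcd : ∀ t ∈ Icc (0 : ℝ) (1 / 2), HasDerivWithinAt c (F (c t)) (Icc 0 (1 / 2)) t := by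
    intro t ht
    apply ODE.hasDerivWithinAt_picard_Icc (t₀ := 0) (by constructor <;> norm_num)
      hPL.continuousOn_uncurry α.continuous_compProj.continuousOn
      (fun _ ht' => α.compProj_mem_closedBall hPL.mul_max_le)
      z₀ ht |>.congr_of_mem _ ht
    intro t' ht'
    nth_rw 1 [hc, ← hα]
    rw [ODE.FunSpace.compProj_of_mem ht', ODE.FunSpace.next_apply]
  have hsol : SolvesOn H (fun t => (c t).1) (fun t => (c t).2) (Icc 0 (1 / 2)) := fun t ht =>
    ⟨(hcd t ht).fst, (hcd t ht).snd⟩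
  have hmaps : MapsTo (fun t : ℝ => (1 / 2) * t) (Icc 0 1) (Icc 0 (1 / 2)) := fun t ht =>
    ⟨by linarith [ht.1], by linarith [ht.2]⟩
  refine ⟨fun t => (c ((1 / 2) * t)).1, fun t => (1 / 2 : ℝ) • (c ((1 / 2) * t)).2,
    hsol.rescale (fun t _ w => hH.homogeneous _ (hball _ (hcb t)).1 _ _ (by norm_num)) hmaps,
    by simp [hc0, hz₀], by simp [hc0, hz₀], fun t _ => ⟨(hball _ (hcb _)).1, ?_⟩⟩
  rw [norm_smul]
  norm_num
  linarith [(hball _ (hcb (1 / 2 * t))).2]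

end IsSprayOnBall

/-! ### The exponential flow in coordinates and the convexity of balls -/

/-- `X q w`, `V q w` is the solution with initial data `q`, `w` for `q` in the closed ball of radius
`δ₀` and `w` of norm at most `ρ`; the remaining fields are the properties of these solutions from
which the convexity of the small balls follows. -/
structure IsExpFlow {E : Type*} [NormedAddCommGroup E] [NormedSpace ℝ E] (H : E → E → E)
    (p : E) (R ρ δ₀ : ℝ) (X V : E → E → ℝ → E) : Prop where
  speed_pos : 0 < ρ
  radius_pos : 0 < δ₀
  radius_lt : δ₀ < R
  solvesOn : ∀ q ∈ Metric.closedBall p δ₀, ∀ w : E, ‖w‖ ≤ ρ → SolvesOn H (X q w) (V q w) (Icc 0 1)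
  fst_zero : ∀ q ∈ Metric.closedBall p δ₀, ∀ w : E, ‖w‖ ≤ ρ → X q w 0 = q
  snd_zero : ∀ q ∈ Metric.closedBall p δ₀, ∀ w : E, ‖w‖ ≤ ρ → V q w 0 = w
  mem_ball : ∀ q ∈ Metric.closedBall p δ₀, ∀ w : E, ‖w‖ ≤ ρ → ∀ t ∈ Icc (0 : ℝ) 1,
    X q w t ∈ Metric.ball p R
  snd_ne_zero : ∀ q ∈ Metric.closedBall p δ₀, ∀ w : E, ‖w‖ ≤ ρ → w ≠ 0 → ∀ t ∈ Icc (0 : ℝ) 1,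
    V q w t ≠ 0
  approx : ∀ q ∈ Metric.closedBall p δ₀, ∀ w : E, ‖w‖ ≤ ρ →
    ∀ q' ∈ Metric.closedBall p δ₀, ∀ w' : E, ‖w'‖ ≤ ρ →
    ‖X q w 1 - X q' w' 1 - (q - q') - (w - w')‖ ≤ 1 / 2 * max ‖q - q'‖ ‖w - w'‖
  scale : ∀ q ∈ Metric.closedBall p δ₀, ∀ w : E, ‖w‖ ≤ ρ → ∀ s ∈ Icc (0 : ℝ) 1,
    X q (s • w) 1 = X q w s
  surj : ∀ q ∈ Metric.closedBall p δ₀, ∀ r ∈ Metric.closedBall p δ₀, ∃ w : E, ‖w‖ < ρ ∧ X q w 1 = r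
  small : ∀ x v : ℝ → E, SolvesOn H x v (Icc 0 1) →
    (∀ t ∈ Icc (0 : ℝ) 1, x t ∈ Metric.closedBall p δ₀) → ‖v 0‖ < ρ
  convex : ∀ q ∈ Metric.closedBall p δ₀, ∀ w : E, ‖w‖ ≤ ρ → ∀ δ, q ∈ Metric.ball p δ →
    X q w 1 ∈ Metric.ball p δ → ∀ t ∈ Icc (0 : ℝ) 1, X q w t ∈ Metric.ball p δ
  strictConvex : ∀ q ∈ Metric.closedBall p δ₀, ∀ w : E, ‖w‖ ≤ ρ → w ≠ 0 → ∀ δ,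
    q ∈ Metric.closedBall p δ → X q w 1 ∈ Metric.closedBall p δ → ∀ t ∈ Ioo (0 : ℝ) 1,
    X q w t ∈ Metric.ball p δ

namespace IsSprayOnBall

variable {E : Type*} [NormedAddCommGroup E] [InnerProductSpace ℝ E] {H : E → E → E} {p : E}
  {R K : ℝ}

theorem deriv2_norm_sub_sq {x v : ℝ → E} (h : SolvesOn H x v (Icc 0 1)) {t : ℝ}
    (ht : t ∈ Ioo (0 : ℝ) 1) :
    deriv^[2] (fun t => ‖x t - p‖ ^ 2) t =
      2 * (inner ℝ (v t) (v t) + inner ℝ (x t - p) (H (x t) (v t))) := by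
  have hx : ∀ s ∈ Ioo (0 : ℝ) 1, HasDerivAt x (v s) s := fun s hs =>
    (h s (Ioo_subset_Icc_self hs)).1.hasDerivAt (Icc_mem_nhds hs.1 hs.2)
  have hv : HasDerivAt v (H (x t) (v t)) t :=
    (h t (Ioo_subset_Icc_self ht)).2.hasDerivAt (Icc_mem_nhds ht.1 ht.2)
  have h1 : deriv (fun t => ‖x t - p‖ ^ 2) =ᶠ[𝓝 t] fun s => 2 * inner ℝ (x s - p) (v s) := by
    filter_upwards [Ioo_mem_nhds ht.1 ht.2] with s hs
    exact ((hx s hs).sub_const p).norm_sq.deriv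
  rw [Function.iterate_succ, Function.iterate_one, Function.comp_apply, h1.deriv_eq]
  have h2 := ((((hx t ht).sub_const p).inner ℝ hv).const_mul 2).deriv
  rw [h2]; ring

theorem continuousOn_norm_sub_sq {x v : ℝ → E} (h : SolvesOn H x v (Icc 0 1)) :
    ContinuousOn (fun t => ‖x t - p‖ ^ 2) (Icc 0 1) :=
  (h.continuousOn_fst.sub continuousOn_const).norm.pow 2

/-- The right-hand side is the second derivative of `‖x - p‖²` along a solution. The inner product
with `H` is at least `-R K ‖v‖² ≥ -‖v‖² / 2`, so it uses up at most half of the kinetic term. -/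
theorem half_norm_sq_le (hH : IsSprayOnBall H p R K) (hRK : 2 * K * R ≤ 1) {x v : E}
    (hx : x ∈ Metric.ball p R) : ‖v‖ ^ 2 ≤ 2 * (inner ℝ v v + inner ℝ (x - p) (H x v)) := by
  have hK := hH.const_pos
  have h1 := abs_real_inner_le_norm (x - p) (H x v)
  have h2 := hH.norm_le hx (le_refl ‖v‖)
  have h3 : ‖x - p‖ ≤ R := (mem_ball_iff_norm.1 hx).le
  have h4 : ‖x - p‖ * ‖H x v‖ ≤ R * (K * ‖v‖ ^ 2) :=
    mul_le_mul h3 h2 (norm_nonneg _) hH.radius_pos.le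
  have h5 := neg_abs_le (inner ℝ (x - p) (H x v))
  rw [real_inner_self_eq_norm_sq]
  nlinarith [sq_nonneg ‖v‖]

theorem convexOn_norm_sub_sq (hH : IsSprayOnBall H p R K) (hRK : 2 * K * R ≤ 1) {x v : ℝ → E}
    (h : SolvesOn H x v (Icc 0 1)) (hx : ∀ t ∈ Icc (0 : ℝ) 1, x t ∈ Metric.ball p R) :
    ConvexOn ℝ (Icc 0 1) (fun t => ‖x t - p‖ ^ 2) := by
  have hd : ∀ s ∈ Ioo (0 : ℝ) 1,
      HasDerivAt (fun t => ‖x t - p‖ ^ 2) (2 * inner ℝ (x s - p) (v s)) s := fun s hs =>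
    (((h s (Ioo_subset_Icc_self hs)).1.hasDerivAt (Icc_mem_nhds hs.1 hs.2)).sub_const p).norm_sq
  refine convexOn_of_deriv2_nonneg (convex_Icc 0 1) (continuousOn_norm_sub_sq h) ?_ ?_ ?_
  · rw [interior_Icc]
    exact fun s hs => (hd s hs).differentiableAt.differentiableWithinAt
  · rw [interior_Icc]
    refine DifferentiableOn.congr (f := fun s => 2 * inner ℝ (x s - p) (v s)) ?_
      fun s hs => (hd s hs).deriv
    intro s hs
    have h1 := h s (Ioo_subset_Icc_self hs)
    have hn := Icc_mem_nhds hs.1 hs.2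
    exact ((((h1.1.hasDerivAt hn).sub_const p).inner ℝ
      (h1.2.hasDerivAt hn)).const_mul 2).differentiableAt.differentiableWithinAt
  · rw [interior_Icc]
    intro t ht
    rw [deriv2_norm_sub_sq h ht]
    exact (sq_nonneg _).trans (hH.half_norm_sq_le hRK (hx t (Ioo_subset_Icc_self ht)))

theorem strictConvexOn_norm_sub_sq (hH : IsSprayOnBall H p R K) (hRK : 2 * K * R ≤ 1)
    {x v : ℝ → E} (h : SolvesOn H x v (Icc 0 1))
    (hx : ∀ t ∈ Icc (0 : ℝ) 1, x t ∈ Metric.ball p R) (hv : ∀ t ∈ Icc (0 : ℝ) 1, v t ≠ 0) :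
    StrictConvexOn ℝ (Icc 0 1) (fun t => ‖x t - p‖ ^ 2) := by
  refine strictConvexOn_of_deriv2_pos (convex_Icc 0 1) (continuousOn_norm_sub_sq h) ?_
  rw [interior_Icc]
  intro t ht
  rw [deriv2_norm_sub_sq h ht]
  have := norm_pos_iff.2 (hv t (Ioo_subset_Icc_self ht))
  exact lt_of_lt_of_le (by positivity) (hH.half_norm_sq_le hRK (hx t (Ioo_subset_Icc_self ht)))

theorem exists_isExpFlow [CompleteSpace E] (hH : IsSprayOnBall H p R K) :
    ∃ ρ δ₀ X V, IsExpFlow H p R ρ δ₀ X V := by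
  have hK := hH.const_pos
  have hR := hH.radius_pos
  -- On this radius squared distances to `p` are convex along solutions.
  set R' := min R (1 / (2 * K)) with hR'
  have hR'0 : 0 < R' := lt_min hR (by positivity)
  have hR'R : R' ≤ R := min_le_left _ _
  have hRK : 2 * K * R' ≤ 1 := by
    have : R' ≤ 1 / (2 * K) := min_le_right _ _
    rw [le_div_iff₀ (by positivity)] at this
    linarith
  replace hH := hH.mono_radius hR'0 hR'R
  -- `a` bounds all speeds: `K (a² + a) ≤ 2Ka ≤ 1/6`, so the error constant `3ε` of
  -- `norm_sub_sub_le` is 1/2. Initial speeds are at most `ρ = a / 2`. The radius `a / 64` makes any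
  -- two points of the ball closer than `a / 8`, the radius covered below, and satisfies `4δ < η`
  -- for `η = a / 4`.
  set a := min (R' / 4) (min 1 (1 / (12 * K))) with ha
  have ha0 : 0 < a := lt_min (by positivity) (lt_min one_pos (by positivity))
  have haR : 4 * a ≤ R' := by have : a ≤ R' / 4 := min_le_left _ _; linarith
  have ha1 : a ≤ 1 := (min_le_right _ _).trans (min_le_left _ _)
  have haK : 12 * K * a ≤ 1 := by
    have : a ≤ 1 / (12 * K) := (min_le_right _ _).trans (min_le_right _ _)
    rw [le_div_iff₀ (by positivity)] at this
    linarith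
  have hex : ∀ q w : E, ∃ x v : ℝ → E, q ∈ Metric.closedBall p (a / 64) → ‖w‖ ≤ a / 2 →
      SolvesOn H x v (Icc 0 1) ∧ x 0 = q ∧ v 0 = w ∧
        ∀ t ∈ Icc (0 : ℝ) 1, x t ∈ Metric.ball p R' ∧ ‖v t‖ ≤ a := by
    intro q w
    by_cases h : q ∈ Metric.closedBall p (a / 64) ∧ ‖w‖ ≤ a / 2
    · obtain ⟨x, v, hxv⟩ := hH.exists_solvesOn (q := q) (w := w) ha0 (by nlinarith)
        (by have := Metric.mem_closedBall.1 h.1; linarith) (by linarith [h.2])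
      exact ⟨x, v, fun _ _ => hxv⟩
    · exact ⟨0, 0, fun h1 h2 => (h ⟨h1, h2⟩).elim⟩
  choose X V hXV using hex
  have hε : K * (a ^ 2 + a) ≤ 1 / 6 := by nlinarith
  have hne : ∀ q ∈ Metric.closedBall p (a / 64), ∀ w : E, ‖w‖ ≤ a / 2 → w ≠ 0 →
      ∀ t ∈ Icc (0 : ℝ) 1, V q w t ≠ 0 := by
    intro q hq w hw hw0 t ht h0
    obtain ⟨h1, h2, h3, h4⟩ := hXV q w hq hw
    have hwp := norm_pos_iff.2 hw0
    have h5 : 5 * K * ‖w‖ < 1 := by nlinarith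
    -- Applied with `η = ‖w‖`: a vanishing velocity would give `‖w‖ ≤ 5K‖w‖² < ‖w‖`.
    have h := hH.norm_velocity_sub_le h1 (fun t ht => (h4 t ht).1) hwp (by rw [h3])
      (by linarith) ht
    rw [h0, h3, zero_sub, norm_neg] at h
    have h6 : 5 * K * ‖w‖ ^ 2 * t ≤ 5 * K * ‖w‖ ^ 2 * 1 := by gcongr; exact ht.2
    nlinarith
  have happ : ∀ q ∈ Metric.closedBall p (a / 64), ∀ w : E, ‖w‖ ≤ a / 2 →
      ∀ q' ∈ Metric.closedBall p (a / 64), ∀ w' : E, ‖w'‖ ≤ a / 2 →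
      ‖X q w 1 - X q' w' 1 - (q - q') - (w - w')‖ ≤ 1 / 2 * max ‖q - q'‖ ‖w - w'‖ := by
    intro q hq w hw q' hq' w' hw'
    obtain ⟨h1, h2, h3, h4⟩ := hXV q w hq hw
    obtain ⟨h1', h2', h3', h4'⟩ := hXV q' w' hq' hw'
    have := hH.norm_sub_sub_le h1 h1' (fun t ht => (h4 t ht).1) (fun t ht => (h4' t ht).1)
      (fun t ht => (h4 t ht).2) (fun t ht => (h4' t ht).2) hε (by norm_num)
      (right_mem_Icc.2 zero_le_one)
    rw [h2, h2', h3, h3', one_smul] at this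
    norm_num at this ⊢
    exact this
  have hsc : ∀ q ∈ Metric.closedBall p (a / 64), ∀ w : E, ‖w‖ ≤ a / 2 → ∀ s ∈ Icc (0 : ℝ) 1,
      X q (s • w) 1 = X q w s := by
    intro q hq w hw s hs
    have hsw : ‖s • w‖ ≤ a / 2 := by
      rw [norm_smul, Real.norm_of_nonneg hs.1]
      exact (mul_le_of_le_one_left (norm_nonneg _) hs.2).trans hw
    obtain ⟨h1, h2, h3, h4⟩ := hXV q w hq hw
    obtain ⟨h1', h2', h3', h4'⟩ := hXV q (s • w) hq hsw
    have hmaps : MapsTo (s * ·) (Icc (0 : ℝ) 1) (Icc (0 : ℝ) 1) := fun t ht =>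
      ⟨mul_nonneg hs.1 ht.1, mul_le_one₀ hs.2 ht.1 ht.2⟩
    have h5 := h1.rescale (fun t ht w => hH.homogeneous_of_nonneg (h4 t ht).1 w hs.1) hmaps
    -- Used as a uniqueness statement: the two curves have the same initial data, so the right-hand
    -- side is zero.
    have := hH.norm_sub_sub_le h1' h5 (fun t ht => (h4' t ht).1)
      (fun t ht => (h4 _ (hmaps ht)).1) (fun t ht => (h4' t ht).2) (ρ := a)
      (fun t ht => by
        rw [norm_smul, Real.norm_of_nonneg hs.1]
        exact (mul_le_of_le_one_left (norm_nonneg _) hs.2).trans (h4 _ (hmaps ht)).2)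
      hε (by norm_num) (right_mem_Icc.2 zero_le_one)
    simpa [h2, h2', h3, h3', sub_eq_zero] using this
  refine ⟨a / 2, a / 64, X, V, by positivity, by positivity, by linarith,
    fun q hq w hw => (hXV q w hq hw).1, fun q hq w hw => (hXV q w hq hw).2.1,
    fun q hq w hw => (hXV q w hq hw).2.2.1,
    fun q hq w hw t ht => Metric.ball_subset_ball hR'R ((hXV q w hq hw).2.2.2 t ht).1,
    hne, happ, hsc, ?_, ?_, ?_, ?_⟩
  · intro q hq r hr
    have hA : ApproximatesLinearOn (fun w => X q w 1)
        ((ContinuousLinearEquiv.refl ℝ E : E ≃L[ℝ] E) : E →L[ℝ] E)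
        (Metric.closedBall 0 (a / 4)) (1 / 2) := by
      intro w hw w' hw'
      rw [mem_closedBall_zero_iff] at hw hw'
      have := happ q hq w (by linarith) q hq w' (by linarith)
      simpa using this
    -- The bound 1 is prescribed, which is valid even for trivial `E`. The image of the ball of
    -- radius `a / 4` then contains the ball of radius `(1 - 1/2) · a / 4` around `q`, and `a / 4 <
    -- ρ` makes the speed bound strict.
    let N : ((ContinuousLinearEquiv.refl ℝ E : E ≃L[ℝ] E) : E →L[ℝ] E).NonlinearRightInverse :=
      { toFun := id
        nnnorm := 1
        bound' := fun y => by simp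
        right_inv' := fun y => rfl }
    have hX0 : X q 0 1 = q := by
      have := hsc q hq 0 (by rw [norm_zero]; positivity) 0 (by simp)
      rw [smul_zero] at this
      rw [this, (hXV q 0 hq (by rw [norm_zero]; positivity)).2.1]
    have hsurj := hA.surjOn_closedBall_of_nonlinearRightInverse N (ε := a / 4) (b := 0)
      (by positivity) subset_rfl
    have hr' : r ∈ Metric.closedBall (X q 0 1)
        ((((N.nnnorm)⁻¹ : ℝ≥0) - ((1 / 2 : ℝ≥0) : ℝ)) * (a / 4)) := by
      rw [Metric.mem_closedBall] at hq hr ⊢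
      have hd := dist_triangle_right r q p
      have : (((N.nnnorm)⁻¹ : ℝ≥0) - ((1 / 2 : ℝ≥0) : ℝ)) = 1 / 2 := by
        simp only [N]; norm_num
      rw [this, hX0]
      linarith
    obtain ⟨w, hw, hwr⟩ := hsurj hr'
    rw [mem_closedBall_zero_iff] at hw
    exact ⟨w, by linarith, hwr⟩
  · intro x v h hx
    have := hH.norm_velocity_le_of_forall_mem_closedBall h hx (η := a / 4) (by positivity)
      (by nlinarith) (by linarith) (by linarith)
    linarith
  · intro q hq w hw δ hqδ hrδ t ht
    obtain ⟨h1, h2, h3, h4⟩ := hXV q w hq hw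
    have hc := hH.convexOn_norm_sub_sq hRK h1 (fun t ht => (h4 t ht).1)
    have := hc.le_max_of_mem_Icc (left_mem_Icc.2 zero_le_one) (right_mem_Icc.2 zero_le_one) ht
    rw [mem_ball_iff_norm] at *
    have hδ0 : 0 ≤ δ := (norm_nonneg _).trans hqδ.le
    refine lt_of_pow_lt_pow_left₀ 2 hδ0 (this.trans_lt (max_lt ?_ ?_))
    · simp only [h2]; gcongr
    · gcongr
  · intro q hq w hw hw0 δ hqδ hrδ t ht
    obtain ⟨h1, h2, h3, h4⟩ := hXV q w hq hw
    have hc := hH.strictConvexOn_norm_sub_sq hRK h1 (fun t ht => (h4 t ht).1) (hne q hq w hw hw0)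
    have := hc.lt_on_openSegment (left_mem_Icc.2 zero_le_one) (right_mem_Icc.2 zero_le_one)
      zero_ne_one (z := t) (by rwa [openSegment_eq_Ioo zero_lt_one])
    rw [mem_closedBall_iff_norm] at *
    have hδ0 : 0 ≤ δ := (norm_nonneg _).trans hqδ
    rw [mem_ball_iff_norm]
    refine lt_of_pow_lt_pow_left₀ 2 hδ0 (this.trans_le (max_le ?_ ?_))
    · rw [h2]; gcongr
    · gcongr

end IsSprayOnBall

/-! ### Coordinates that are locally bi-Lipschitz to the charts -/

/-- `T` is an injective map from `U` to a normed space that is comparable to the charts: it induces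
the topology of `U` and distances measured by `T` and in the charts are locally equivalent. -/
structure IsLipCoord {E H X F : Type*}
    [NormedAddCommGroup E] [NormedSpace ℝ E] [TopologicalSpace H] (I : ModelWithCorners ℝ E H)
    [TopologicalSpace X] [ChartedSpace H X] [NormedAddCommGroup F]
    (T : X → F) (U : Set X) : Prop where
  injOn : InjOn T U
  nhds_eq : ∀ x ∈ U, 𝓝 x = comap T (𝓝 (T x)) ⊓ 𝓟 U
  le_chart : ∀ x ∈ U, ∃ K : ℝ≥0, ∃ t ∈ 𝓝 x, ∀ y ∈ t, ∀ z ∈ t,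
    ‖T y - T z‖ ≤ K * ‖extChartAt I x y - extChartAt I x z‖
  chart_le : ∀ x ∈ U, ∃ K : ℝ≥0, ∃ t ∈ 𝓝 x, ∀ y ∈ t, ∀ z ∈ t,
    ‖extChartAt I x y - extChartAt I x z‖ ≤ K * ‖T y - T z‖

theorem nhds_eq_comap_inf_principal {X F : Type*} [TopologicalSpace X] [TopologicalSpace F]
    {T : X → F} {S : F → X} {U : Set X} {x : X} (hU : U ∈ 𝓝 x) (hT : ContinuousAt T x)
    (hS : ContinuousAt S (T x)) (hST : ∀ y ∈ U, S (T y) = y) :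
    𝓝 x = comap T (𝓝 (T x)) ⊓ 𝓟 U := by
  refine le_antisymm (le_inf (map_le_iff_le_comap.1 hT) (le_principal_iff.2 hU)) ?_
  intro N hN
  have h1 : S ⁻¹' N ∈ 𝓝 (T x) := hS (by rwa [hST x (mem_of_mem_nhds hU)])
  rw [mem_inf_principal]
  filter_upwards [preimage_mem_comap h1] with y hy hyU
  simpa [hST y hyU] using hy

section

variable {E H X F E' H' Y F' : Type*}
    [NormedAddCommGroup E] [NormedSpace ℝ E] [TopologicalSpace H] {I : ModelWithCorners ℝ E H}
    [TopologicalSpace X] [ChartedSpace H X] [NormedAddCommGroup F]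
    [NormedAddCommGroup E'] [NormedSpace ℝ E'] [TopologicalSpace H']
    {I' : ModelWithCorners ℝ E' H'}
    [TopologicalSpace Y] [ChartedSpace H' Y] [NormedAddCommGroup F']
    {T : X → F} {U : Set X} {T' : Y → F'} {U' : Set Y}

theorem IsLipCoord.continuousAt (hT : IsLipCoord I T U) {x : X} (hx : x ∈ U) :
    ContinuousAt T x := by
  rw [ContinuousAt, hT.nhds_eq x hx]
  exact tendsto_comap.mono_left inf_le_left

theorem IsLipCoord.tendsto (hT : IsLipCoord I T U) {ι : Type*} {l : Filter ι} {f : ι → X} {x : X}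
    (hx : x ∈ U) (hf : ∀ᶠ i in l, f i ∈ U) (h : Tendsto (fun i => T (f i)) l (𝓝 (T x))) :
    Tendsto f l (𝓝 x) := by
  rw [hT.nhds_eq x hx, tendsto_inf, tendsto_comap_iff, tendsto_principal]
  exact ⟨h, hf⟩

/-- Replaces the point-dependent charts of `LocLipOn` by one inequality in fixed coordinates;
continuity follows from it, as the coordinates induce the topology. -/
theorem IsLipCoord.locLipOn (hT : IsLipCoord I T U) (hT' : IsLipCoord I' T' U') {f : X → Y}
    {A : Set X} (hA : A ⊆ U) (hf : MapsTo f A U') {C : ℝ≥0}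
    (h : ∀ y ∈ A, ∀ z ∈ A, ‖T' (f y) - T' (f z)‖ ≤ C * ‖T y - T z‖) : LocLipOn I I' f A := by
  intro x hx
  have hc : ContinuousWithinAt f A x := by
    refine hT'.tendsto (hf hx) (eventually_mem_nhdsWithin.mono hf) ?_
    rw [tendsto_iff_norm_sub_tendsto_zero]
    have h1 : Tendsto (fun y => (C : ℝ) * ‖T y - T x‖) (𝓝[A] x) (𝓝 0) := by
      have := (tendsto_iff_norm_sub_tendsto_zero.1
        ((hT.continuousAt (hA hx)).continuousWithinAt (s := A))).const_mul (C : ℝ)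
      simpa using this
    exact squeeze_zero' (Eventually.of_forall fun _ => norm_nonneg _)
      (eventually_mem_nhdsWithin.mono fun y hy => h y hy x hx) h1
  refine ⟨hc, ?_⟩
  obtain ⟨K₁, t₁, ht₁, h₁⟩ := hT.le_chart x (hA hx)
  obtain ⟨K₂, t₂, ht₂, h₂⟩ := hT'.chart_le (f x) (hf hx)
  refine ⟨K₂ * (C * K₁), (t₁ ∩ f ⁻¹' t₂) ∩ A,
    inter_mem (inter_mem (mem_nhdsWithin_of_mem_nhds ht₁) (hc ht₂)) self_mem_nhdsWithin, ?_⟩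
  rintro y ⟨⟨hy₁, hy₂⟩, hyA⟩ z ⟨⟨hz₁, hz₂⟩, hzA⟩
  calc _ ≤ K₂ * ‖T' (f y) - T' (f z)‖ := h₂ _ hy₂ _ hz₂
    _ ≤ K₂ * (C * ‖T y - T z‖) := by gcongr; exact h y hyA z hzA
    _ ≤ K₂ * (C * (K₁ * ‖extChartAt I x y - extChartAt I x z‖)) := by
      gcongr; exact h₁ y hy₁ z hz₁
    _ = _ := by push_cast; ring

/-- The lower bound `h'` gives injectivity and also the Lipschitz estimate for the inverse, so no
formula for the inverse is needed. -/
theorem IsLipCoord.isLipeoOn [Nonempty X] (hT : IsLipCoord I T U) (hT' : IsLipCoord I' T' U') {f : X → Y}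
    {A : Set X} {B : Set Y} (hA : A ⊆ U) (hB : B ⊆ U') (hf : MapsTo f A B) (hs : SurjOn f A B)
    {C : ℝ≥0} (h : ∀ y ∈ A, ∀ z ∈ A, ‖T' (f y) - T' (f z)‖ ≤ C * ‖T y - T z‖)
    (h' : ∀ y ∈ A, ∀ z ∈ A, ‖T y - T z‖ ≤ C * ‖T' (f y) - T' (f z)‖) : IsLipeoOn I I' f A B := by
  have hinj : InjOn f A := fun y hy z hz hyz => by
    have := h' y hy z hz
    rw [hyz, sub_self, norm_zero, mul_zero] at this
    exact hT.injOn (hA hy) (hA hz) (sub_eq_zero.1 (norm_le_zero_iff.1 this))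
  refine ⟨hf, hT.locLipOn hT' hA (fun x hx => hB (hf hx)) h, ?_⟩
  rcases A.eq_empty_or_nonempty with rfl | ⟨a, ha⟩
  · have hB0 : B = ∅ := by
      rw [← subset_empty_iff]; intro b hb; obtain ⟨a, ha, -⟩ := hs hb; exact ha
    subst hB0
    exact ⟨fun _ => Classical.arbitrary X, mapsTo_empty _ _,
      ⟨fun _ h => h.elim, fun _ h => h.elim⟩, fun _ h => h.elim⟩
  · have hg : MapsTo (Function.invFunOn f A) B A := fun y hy => Function.invFunOn_mem (hs hy)
    have hfg : ∀ y ∈ B, f (Function.invFunOn f A y) = y := fun y hy =>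
      Function.invFunOn_eq (hs hy)
    refine ⟨Function.invFunOn f A, hg, ⟨fun x hx => ?_, hfg⟩,
      hT'.locLipOn hT hB (hg.mono_right hA) (C := C) fun y hy z hz => ?_⟩
    · exact hinj (hg (hf hx)) hx (hfg _ (hf hx))
    · have := h' _ (hg hy) _ (hg hz)
      rwa [hfg y hy, hfg z hz] at this

theorem IsLipCoord.prodMap (hT : IsLipCoord I T U) (hT' : IsLipCoord I' T' U') :
    IsLipCoord (I.prod I') (Prod.map T T') (U ×ˢ U') where
  injOn := fun a ha b hb h => Prod.ext (hT.injOn ha.1 hb.1 (congrArg Prod.fst h))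
    (hT'.injOn ha.2 hb.2 (congrArg Prod.snd h))
  nhds_eq := by
    rintro ⟨x, y⟩ ⟨hx, hy⟩
    rw [nhds_prod_eq, hT.nhds_eq x hx, hT'.nhds_eq y hy, Prod.map_apply, nhds_prod_eq,
      ← prod_principal_principal, ← prod_inf_prod, prod_comap_comap_eq]
    rfl
  le_chart := by
    rintro ⟨x, y⟩ ⟨hx, hy⟩
    obtain ⟨K₁, t₁, ht₁, h₁⟩ := hT.le_chart x hx
    obtain ⟨K₂, t₂, ht₂, h₂⟩ := hT'.le_chart y hy
    refine ⟨max K₁ K₂, t₁ ×ˢ t₂, prod_mem_nhds ht₁ ht₂, fun a ha b hb => ?_⟩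
    rw [extChartAt_prod]
    refine max_le ((h₁ _ ha.1 _ hb.1).trans ?_) ((h₂ _ ha.2 _ hb.2).trans ?_)
    · exact mul_le_mul (le_max_left _ _)
        (norm_fst_le (extChartAt I x a.1 - extChartAt I x b.1, extChartAt I' y a.2 - extChartAt I' y b.2)) (norm_nonneg _)
        (by positivity)
    · exact mul_le_mul (le_max_right _ _)
        (norm_snd_le (extChartAt I x a.1 - extChartAt I x b.1, extChartAt I' y a.2 - extChartAt I' y b.2)) (norm_nonneg _)
        (by positivity)
  chart_le := by
    rintro ⟨x, y⟩ ⟨hx, hy⟩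
    obtain ⟨K₁, t₁, ht₁, h₁⟩ := hT.chart_le x hx
    obtain ⟨K₂, t₂, ht₂, h₂⟩ := hT'.chart_le y hy
    refine ⟨max K₁ K₂, t₁ ×ˢ t₂, prod_mem_nhds ht₁ ht₂, fun a ha b hb => ?_⟩
    rw [extChartAt_prod]
    refine max_le ((h₁ _ ha.1 _ hb.1).trans ?_) ((h₂ _ ha.2 _ hb.2).trans ?_)
    · exact mul_le_mul (le_max_left _ _)
        (norm_fst_le (T a.1 - T b.1, T' a.2 - T' b.2)) (norm_nonneg _)
        (by positivity)
    · exact mul_le_mul (le_max_right _ _)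
        (norm_snd_le (T a.1 - T b.1, T' a.2 - T' b.2)) (norm_nonneg _)
        (by positivity)

/-- A map which is obtained from the charts, and from which the charts are obtained, by
composition with locally Lipschitz maps is a Lipschitz coordinate. -/
theorem IsLipCoord.of_eventuallyEq {S : F → X} (hU : IsOpen U)
    (hST : ∀ y ∈ U, S (T y) = y)
    (h : ∀ x ∈ U, ∃ G : E → F, ∃ G' : F → E, ∃ K : ℝ≥0,
      (∃ s ∈ 𝓝 (extChartAt I x x), LipschitzOnWith K G s) ∧
      (∃ s ∈ 𝓝 (T x), LipschitzOnWith K G' s) ∧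
      (∀ᶠ y in 𝓝 x, T y = G (extChartAt I x y)) ∧
      (∀ᶠ z in 𝓝 (T x), S z ∈ (extChartAt I x).source ∧ extChartAt I x (S z) = G' z)) :
    IsLipCoord I T U := by
  have hTc : ∀ x ∈ U, ContinuousAt T x := by
    intro x hx
    obtain ⟨G, -, K, ⟨s, hs, hG⟩, -, hTG, -⟩ := h x hx
    have h1 : ContinuousAt (fun y => G (extChartAt I x y)) x :=
      ContinuousAt.comp (f := extChartAt I x) (g := G)
        ((hG.continuousOn _ (mem_of_mem_nhds hs)).continuousAt hs) (continuousAt_extChartAt x)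
    exact h1.congr (hTG.mono fun _ h => h.symm)
  have hn : ∀ x ∈ U, ContinuousAt S (T x) := by
    intro x hx
    obtain ⟨-, G', K, -, ⟨s, hs, hG⟩, -, hSG⟩ := h x hx
    have h1 : ContinuousAt G' (T x) :=
      (hG.continuousOn _ (mem_of_mem_nhds hs)).continuousAt hs
    have h2 : G' (T x) = extChartAt I x x := by
      rw [← (hSG.self_of_nhds).2, hST x hx]
    have h3 : ContinuousAt (fun z => (extChartAt I x).symm (G' z)) (T x) := by
      refine ContinuousAt.comp (f := G') (g := (extChartAt I x).symm) ?_ h1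
      rw [h2]; exact continuousAt_extChartAt_symm x
    refine h3.congr (hSG.mono fun z hz => ?_)
    change (extChartAt I x).symm (G' z) = S z
    rw [← hz.2, (extChartAt I x).left_inv hz.1]
  refine ⟨fun y hy z hz hyz => by rw [← hST y hy, ← hST z hz, hyz], fun x hx =>
    nhds_eq_comap_inf_principal (hU.mem_nhds hx) (hTc x hx) (hn x hx) hST, ?_, ?_⟩
  · intro x hx
    obtain ⟨G, -, K, ⟨s, hs, hG⟩, -, hTG, -⟩ := h x hx
    refine ⟨K, {y | T y = G (extChartAt I x y)} ∩ extChartAt I x ⁻¹' s,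
      inter_mem hTG (continuousAt_extChartAt x hs), ?_⟩
    rintro y ⟨hy, hys⟩ z ⟨hz, hzs⟩
    change T y = _ at hy
    change T z = _ at hz
    rw [hy, hz, ← dist_eq_norm, ← dist_eq_norm]
    exact hG.dist_le_mul _ hys _ hzs
  · intro x hx
    obtain ⟨-, G', K, -, ⟨s, hs, hG⟩, -, hSG⟩ := h x hx
    refine ⟨K, (T ⁻¹' {z | S z ∈ (extChartAt I x).source ∧ extChartAt I x (S z) = G' z}
      ∩ T ⁻¹' s) ∩ U, inter_mem (inter_mem (hTc x hx hSG) (hTc x hx hs)) (hU.mem_nhds hx), ?_⟩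
    rintro y ⟨⟨hy, hys⟩, hyU⟩ z ⟨⟨hz, hzs⟩, hzU⟩
    have hy2 := hy.2
    have hz2 := hz.2
    rw [hST y hyU] at hy2
    rw [hST z hzU] at hz2
    rw [hy2, hz2, ← dist_eq_norm, ← dist_eq_norm]
    exact hG.dist_le_mul _ hys _ hzs

end

/-! ### Coordinate changes and components of tangent vectors -/

theorem mem_transition_source {X Y Z : Type*} [TopologicalSpace X] [TopologicalSpace Y]
    [TopologicalSpace Z] {e : OpenPartialHomeomorph X Y} {e' : OpenPartialHomeomorph X Z} {x : X} (hx : x ∈ e.source) (hx' : x ∈ e'.source) :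
    e x ∈ (e.symm ≫ₕ e').source := by
  simp [hx, hx']

theorem transition_apply {X Y Z : Type*} [TopologicalSpace X] [TopologicalSpace Y]
    [TopologicalSpace Z] {e : OpenPartialHomeomorph X Y} {e' : OpenPartialHomeomorph X Z} {x : X} (hx : x ∈ e.source) : (e.symm ≫ₕ e') (e x) = e' x := by
  simp [hx]

section

variable {n : ℕ} {M : Type*} [TopologicalSpace M] [ChartedSpace (EuclideanSpace ℝ (Fin n)) M]
  {e e' : OpenPartialHomeomorph M (EuclideanSpace ℝ (Fin n))}

theorem mem_maximalAtlas_of_mem_c21Charts (he : e ∈ c21Charts n M) :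
    e ∈ IsManifold.maximalAtlas (𝓡 n) 2 M := by
  rw [IsManifold.maximalAtlas, mem_maximalAtlas_iff]
  intro e' he'
  have h := he e' he'
  have key : ∀ f : OpenPartialHomeomorph (EuclideanSpace ℝ (Fin n)) (EuclideanSpace ℝ (Fin n)),
      ContDiffOn ℝ 2 f f.source → ContDiffOn ℝ 2 f.symm f.target →
      f ∈ contDiffGroupoid 2 (𝓡 n) := by
    intro f h1 h2
    rw [contDiffGroupoid, mem_groupoid_of_pregroupoid]
    simpa [contDiffPregroupoid] using ⟨h1, h2⟩
  have hs : (e.symm ≫ₕ e').symm = e'.symm ≫ₕ e := by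
    rw [OpenPartialHomeomorph.trans_symm_eq_symm_trans_symm, OpenPartialHomeomorph.symm_symm]
  have hs' : (e'.symm ≫ₕ e).symm = e.symm ≫ₕ e' := by
    rw [OpenPartialHomeomorph.trans_symm_eq_symm_trans_symm, OpenPartialHomeomorph.symm_symm]
  refine ⟨key _ h.1.1 ?_, key _ h.2.1 ?_⟩
  · rw [← OpenPartialHomeomorph.symm_source, hs]; exact h.2.1
  · rw [← OpenPartialHomeomorph.symm_source, hs']; exact h.1.1

/-- `c21Charts` compares a chart only with those of the atlas; two such charts are compatible with
each other through the `C²` maximal atlas. -/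
theorem contDiffOn_transition (he : e ∈ c21Charts n M) (he' : e' ∈ c21Charts n M) :
    ContDiffOn ℝ 2 (e.symm ≫ₕ e') (e.symm ≫ₕ e').source := by
  have h := (contDiffGroupoid 2 (𝓡 n)).compatible_of_mem_maximalAtlas
    (mem_maximalAtlas_of_mem_c21Charts he) (mem_maximalAtlas_of_mem_c21Charts he')
  rw [contDiffGroupoid, mem_groupoid_of_pregroupoid] at h
  simpa [contDiffPregroupoid] using h.1

theorem mdifferentiableAt_chart (he : e ∈ c21Charts n M) {x : M} (hx : x ∈ e.source) :
    MDifferentiableAt (𝓡 n) (𝓡 n) e x :=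
  (contMDiffAt_of_mem_maximalAtlas (mem_maximalAtlas_of_mem_c21Charts he) hx).mdifferentiableAt
    (by norm_num)

theorem mdifferentiableAt_chart_symm (he : e ∈ c21Charts n M) {z : EuclideanSpace ℝ (Fin n)}
    (hz : z ∈ e.target) : MDifferentiableAt (𝓡 n) (𝓡 n) e.symm z :=
  ((contMDiffOn_symm_of_mem_maximalAtlas (mem_maximalAtlas_of_mem_c21Charts he)).contMDiffAt
    (e.open_target.mem_nhds hz)).mdifferentiableAt (by norm_num)

theorem differentiableAt_transition (he : e ∈ c21Charts n M) (he' : e' ∈ c21Charts n M)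
    {z : EuclideanSpace ℝ (Fin n)} (hz : z ∈ (e.symm ≫ₕ e').source) :
    DifferentiableAt ℝ (e.symm ≫ₕ e') z :=
  ((contDiffOn_transition he he').contDiffAt
    ((e.symm ≫ₕ e').open_source.mem_nhds hz)).differentiableAt (by norm_num)

theorem contDiffAt_fderiv_transition (he : e ∈ c21Charts n M) (he' : e' ∈ c21Charts n M)
    {z : EuclideanSpace ℝ (Fin n)} (hz : z ∈ (e.symm ≫ₕ e').source) :
    ContDiffAt ℝ 1 (fderiv ℝ (e.symm ≫ₕ e')) z :=
  ((contDiffOn_transition he he').contDiffAt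
    ((e.symm ≫ₕ e').open_source.mem_nhds hz)).fderiv_right (by norm_num)

theorem velocityIn_transition (he : e ∈ c21Charts n M) (he' : e' ∈ c21Charts n M)
    {w : TangentBundle (𝓡 n) M} (hw : w.proj ∈ e.source) (hw' : w.proj ∈ e'.source) :
    velocityIn e' w = fderiv ℝ (e.symm ≫ₕ e') (e w.proj) (velocityIn e w) := by
  have h1 : (e' : M → EuclideanSpace ℝ (Fin n)) =ᶠ[𝓝 w.proj] (e.symm ≫ₕ e') ∘ e := by
    filter_upwards [e.open_source.mem_nhds hw] with x hx
    exact (transition_apply hx).symm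
  have h2 := mfderiv_comp (I := 𝓡 n) (I' := 𝓡 n) (I'' := 𝓡 n) w.proj
    (differentiableAt_transition he he' (mem_transition_source hw hw')).mdifferentiableAt
    (mdifferentiableAt_chart he hw)
  rw [velocityIn, h1.mfderiv_eq, h2, mfderiv_eq_fderiv]
  rfl

/-- The tangent vector with given components in the chart `e`. -/
noncomputable def tangentOf (e : OpenPartialHomeomorph M (EuclideanSpace ℝ (Fin n)))
    (z : EuclideanSpace ℝ (Fin n) × EuclideanSpace ℝ (Fin n)) : TangentBundle (𝓡 n) M :=
  ⟨e.symm z.1, mfderiv (𝓡 n) (𝓡 n) e.symm z.1 z.2⟩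

@[simp]
theorem tangentOf_proj (z : EuclideanSpace ℝ (Fin n) × EuclideanSpace ℝ (Fin n)) :
    (tangentOf e z).proj = e.symm z.1 := rfl

theorem velocityIn_tangentOf (he : e ∈ c21Charts n M)
    {z : EuclideanSpace ℝ (Fin n) × EuclideanSpace ℝ (Fin n)} (hz : z.1 ∈ e.target) :
    velocityIn e (tangentOf e z) = z.2 := by
  have h1 : (e ∘ e.symm : _ → EuclideanSpace ℝ (Fin n)) =ᶠ[𝓝 z.1] id := by
    filter_upwards [e.open_target.mem_nhds hz] with x hx
    exact e.right_inv hx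
  have h2 := mfderiv_comp (I := 𝓡 n) (I' := 𝓡 n) (I'' := 𝓡 n) z.1
    (mdifferentiableAt_chart he (e.map_target hz)) (mdifferentiableAt_chart_symm he hz)
  rw [h1.mfderiv_eq, mfderiv_id] at h2
  exact (DFunLike.congr_fun h2 z.2).symm

theorem tangentOf_velocityIn (he : e ∈ c21Charts n M) {w : TangentBundle (𝓡 n) M}
    (hw : w.proj ∈ e.source) : tangentOf e (e w.proj, velocityIn e w) = w := by
  obtain ⟨x, v⟩ := w
  change x ∈ e.source at hw
  have h1 : (e.symm ∘ e : M → M) =ᶠ[𝓝 x] id := by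
    filter_upwards [e.open_source.mem_nhds hw] with x hx
    exact e.left_inv hx
  have h2 := mfderiv_comp (I := 𝓡 n) (I' := 𝓡 n) (I'' := 𝓡 n) x
    (mdifferentiableAt_chart_symm he (e.map_source hw)) (mdifferentiableAt_chart he hw)
  rw [h1.mfderiv_eq, mfderiv_id] at h2
  have h3 : mfderiv (𝓡 n) (𝓡 n) e.symm (e x) (mfderiv (𝓡 n) (𝓡 n) e x v) = v :=
    (DFunLike.congr_fun h2 v).symm
  rw [tangentOf, velocityIn]
  refine Bundle.TotalSpace.ext (e.left_inv hw) ?_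
  exact heq_of_eq h3

theorem eq_of_velocityIn_eq (he : e ∈ c21Charts n M) {w w' : TangentBundle (𝓡 n) M}
    (hw : w.proj ∈ e.source) (hww' : w.proj = w'.proj) (h : velocityIn e w = velocityIn e w') :
    w = w' := by
  rw [← tangentOf_velocityIn he hw, hww', h, tangentOf_velocityIn he (hww' ▸ hw)]

theorem velocityIn_smul (x : M) (v : TangentSpace (𝓡 n) x) (s : ℝ) :
    velocityIn e ⟨x, s • v⟩ = s • velocityIn e ⟨x, v⟩ :=
  map_smul (mfderiv (𝓡 n) (𝓡 n) e x) s v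

theorem velocityIn_zero (x : M) :
    velocityIn e ⟨x, (0 : TangentSpace (𝓡 n) x)⟩ = 0 :=
  map_zero (mfderiv (𝓡 n) (𝓡 n) e x)

theorem velocityIn_eq_zero_iff (he : e ∈ c21Charts n M) {w : TangentBundle (𝓡 n) M}
    (hw : w.proj ∈ e.source) : velocityIn e w = 0 ↔ w.2 = 0 := by
  obtain ⟨x, v⟩ := w
  refine ⟨fun h => ?_, fun h => ?_⟩
  · have h1 : (⟨x, v⟩ : TangentBundle (𝓡 n) M) = ⟨x, (0 : TangentSpace (𝓡 n) x)⟩ :=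
      eq_of_velocityIn_eq he hw rfl (by rw [h, velocityIn_zero])
    exact eq_of_heq (Bundle.TotalSpace.mk.inj h1).2
  · change v = 0 at h
    subst h
    exact velocityIn_zero x

theorem exists_lipschitzOnWith_transition (he : e ∈ c21Charts n M) (he' : e' ∈ c21Charts n M)
    {z : EuclideanSpace ℝ (Fin n)} (hz : z ∈ (e.symm ≫ₕ e').source) :
    ∃ K : ℝ≥0, ∃ s ∈ 𝓝 z, LipschitzOnWith K (e.symm ≫ₕ e') s :=
  (((contDiffOn_transition he he').contDiffAt
    ((e.symm ≫ₕ e').open_source.mem_nhds hz)).of_le (by norm_num)).exists_lipschitzOnWith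

/-- The tangent map of a `C²` coordinate change is `C¹`, hence locally Lipschitz; Lipschitz
conditions on `TM` thus do not depend on the chart. -/
theorem exists_lipschitzOnWith_tangent_transition (he : e ∈ c21Charts n M)
    (he' : e' ∈ c21Charts n M) {z : EuclideanSpace ℝ (Fin n) × EuclideanSpace ℝ (Fin n)}
    (hz : z.1 ∈ (e.symm ≫ₕ e').source) :
    ∃ K : ℝ≥0, ∃ s ∈ 𝓝 z, LipschitzOnWith K
      (fun z : EuclideanSpace ℝ (Fin n) × EuclideanSpace ℝ (Fin n) =>
        ((e.symm ≫ₕ e') z.1, fderiv ℝ (e.symm ≫ₕ e') z.1 z.2)) s := by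
  refine ContDiffAt.exists_lipschitzOnWith (𝕂 := ℝ) ?_
  have h1 : ContDiffAt ℝ 1 (e.symm ≫ₕ e') z.1 := ((contDiffOn_transition he he').contDiffAt
    ((e.symm ≫ₕ e').open_source.mem_nhds hz)).of_le (by norm_num)
  exact (h1.comp z contDiffAt_fst).prodMk
    (((contDiffAt_fderiv_transition he he' hz).comp z contDiffAt_fst).clm_apply contDiffAt_snd)

/-- The components of the tangent vectors at `q` in a chart, as a linear equivalence. -/
theorem exists_fiber_equiv (he : e ∈ c21Charts n M) {q : M} (hq : q ∈ e.source) :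
    ∃ L : EuclideanSpace ℝ (Fin n) ≃L[ℝ] EuclideanSpace ℝ (Fin n),
      ∀ v, L v = velocityIn e (⟨q, v⟩ : TangentBundle (𝓡 n) M) := by
  let L : EuclideanSpace ℝ (Fin n) →L[ℝ] EuclideanSpace ℝ (Fin n) := mfderiv (𝓡 n) (𝓡 n) e q
  have hL : Function.Injective (L : EuclideanSpace ℝ (Fin n) →ₗ[ℝ] EuclideanSpace ℝ (Fin n)) := by
    refine (injective_iff_map_eq_zero _).2 fun v hv => ?_
    exact (velocityIn_eq_zero_iff he (w := (⟨q, v⟩ : TangentBundle (𝓡 n) M)) hq).1 hv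
  exact ⟨(LinearEquiv.ofInjectiveEndo _ hL).toContinuousLinearEquiv, fun v => rfl⟩

theorem isLipCoord_continuousLinearEquiv {E F : Type*} [NormedAddCommGroup E] [NormedSpace ℝ E]
    [NormedAddCommGroup F] [NormedSpace ℝ F] (L : E ≃L[ℝ] F) :
    IsLipCoord 𝓘(ℝ, E) (fun v : E => L v) univ := by
  refine IsLipCoord.of_eventuallyEq (S := L.symm) isOpen_univ (fun y _ => L.symm_apply_apply y) ?_
  intro x _
  refine ⟨L, L.symm, max ‖(L : E →L[ℝ] F)‖₊ ‖(L.symm : F →L[ℝ] E)‖₊,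
    ⟨univ, univ_mem, ((L : E →L[ℝ] F).lipschitz.weaken (le_max_left _ _)).lipschitzOnWith⟩,
    ⟨univ, univ_mem, ((L.symm : F →L[ℝ] E).lipschitz.weaken (le_max_right _ _)).lipschitzOnWith⟩,
    Eventually.of_forall fun y => by rw [extChartAt_model_space_eq_id]; rfl,
    Eventually.of_forall fun y => by rw [extChartAt_model_space_eq_id]; exact ⟨trivial, rfl⟩⟩

variable [IsC21Manifold n M]

theorem chartAt_mem_c21Charts (x : M) :
    chartAt (EuclideanSpace ℝ (Fin n)) x ∈ c21Charts n M := fun _ he' =>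
  ⟨IsC21Manifold.c21 _ (chart_mem_atlas _ x) _ he', IsC21Manifold.c21 _ he' _ (chart_mem_atlas _ x)⟩

theorem isLipCoord_chart (he : e ∈ c21Charts n M) : IsLipCoord (𝓡 n) e e.source := by
  refine IsLipCoord.of_eventuallyEq (S := e.symm) e.open_source (fun y hy => e.left_inv hy) ?_
  intro x hx
  have hc := chartAt_mem_c21Charts (n := n) x
  set c := chartAt (EuclideanSpace ℝ (Fin n)) x with hc'
  have hxc : x ∈ c.source := mem_chart_source _ x
  obtain ⟨K₁, s₁, hs₁, h₁⟩ := exists_lipschitzOnWith_transition hc he (mem_transition_source hxc hx)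
  obtain ⟨K₂, s₂, hs₂, h₂⟩ := exists_lipschitzOnWith_transition he hc (mem_transition_source hx hxc)
  have hext : ∀ y, extChartAt (𝓡 n) x y = c y := fun y => by simp [hc', extChartAt]
  refine ⟨_, _, max K₁ K₂, ⟨s₁, by rwa [hext], h₁.weaken (le_max_left _ _)⟩,
    ⟨s₂, hs₂, h₂.weaken (le_max_right _ _)⟩, ?_, ?_⟩
  · filter_upwards [c.open_source.mem_nhds hxc] with y hy
    rw [hext, transition_apply hy]
  · have h3 := (e.symm ≫ₕ c).open_source.mem_nhds (mem_transition_source hx hxc)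
    filter_upwards [h3] with z hz
    rw [OpenPartialHomeomorph.trans_source] at hz
    exact ⟨by simpa [extChartAt] using hz.2, by rw [hext]; rfl⟩

/-- Links the preferred charts of the bundle to `velocityIn`, which is defined through `mfderiv`. -/
theorem extChartAt_tangent (w₀ w : TangentBundle (𝓡 n) M)
    (hw : w.proj ∈ (chartAt (EuclideanSpace ℝ (Fin n)) w₀.proj).source) :
    extChartAt (𝓡 n).tangent w₀ w = (chartAt (EuclideanSpace ℝ (Fin n)) w₀.proj w.proj,
      velocityIn (chartAt (EuclideanSpace ℝ (Fin n)) w₀.proj) w) := by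
  have h := tangentMap_chart (I := 𝓡 n) (p := w₀) (q := w) hw
  have h2 : chartAt (ModelProd (EuclideanSpace ℝ (Fin n)) (EuclideanSpace ℝ (Fin n))) w₀ w =
      Bundle.TotalSpace.toProd _ _
        (tangentMap (𝓡 n) (𝓡 n) (chartAt (EuclideanSpace ℝ (Fin n)) w₀.proj) w) := by
    rw [h, Equiv.apply_symm_apply]
  rw [extChartAt_coe, Function.comp_apply, h2]
  rfl

theorem isLipCoord_tangent (he : e ∈ c21Charts n M) :
    IsLipCoord (𝓡 n).tangent
      (fun w : TangentBundle (𝓡 n) M => (e w.proj, velocityIn e w))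
      (Bundle.TotalSpace.proj ⁻¹' e.source) := by
  have hproj : Continuous (Bundle.TotalSpace.proj : TangentBundle (𝓡 n) M → M) :=
    FiberBundle.continuous_proj _ _
  refine IsLipCoord.of_eventuallyEq (S := tangentOf e) (e.open_source.preimage hproj)
    (fun y hy => tangentOf_velocityIn he hy) ?_
  intro x hx
  have hc := chartAt_mem_c21Charts (n := n) x.proj
  set c := chartAt (EuclideanSpace ℝ (Fin n)) x.proj with hc'
  have hxc : x.proj ∈ c.source := mem_chart_source _ x.proj
  obtain ⟨K₁, s₁, hs₁, h₁⟩ := exists_lipschitzOnWith_tangent_transition hc he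
    (z := (c x.proj, velocityIn c x)) (mem_transition_source hxc hx)
  obtain ⟨K₂, s₂, hs₂, h₂⟩ := exists_lipschitzOnWith_tangent_transition he hc
    (z := (e x.proj, velocityIn e x)) (mem_transition_source hx hxc)
  have hext := extChartAt_tangent (n := n) (M := M) x
  refine ⟨_, _, max K₁ K₂, ⟨s₁, by rwa [hext x hxc], h₁.weaken (le_max_left _ _)⟩,
    ⟨s₂, hs₂, h₂.weaken (le_max_right _ _)⟩, ?_, ?_⟩
  · filter_upwards [(c.open_source.preimage hproj).mem_nhds hxc,
      (e.open_source.preimage hproj).mem_nhds hx] with y hy hy'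
    rw [hext y hy, velocityIn_transition hc he hy hy']
    exact Prod.ext (transition_apply hy).symm rfl
  · have h3 : ∀ᶠ z in 𝓝 (e x.proj, velocityIn e x), z.1 ∈ (e.symm ≫ₕ c).source :=
      continuousAt_fst.eventually ((e.symm ≫ₕ c).open_source.mem_nhds (mem_transition_source hx hxc))
    filter_upwards [h3] with z hz
    rw [OpenPartialHomeomorph.trans_source] at hz
    have hz2 : (tangentOf e z).proj ∈ c.source := hz.2
    have hz1 : z.1 ∈ e.target := hz.1
    refine ⟨?_, ?_⟩
    · rw [extChartAt_source, TangentBundle.mem_chart_source_iff]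
      exact hz2
    · rw [hext _ hz2, velocityIn_transition he hc (e.map_target hz1) hz2,
        velocityIn_tangentOf he hz1, tangentOf_proj, e.right_inv hz1]
      rfl

end

/-! ### Solutions on the manifold and their uniqueness -/

/-- Local uniqueness relative to the interval, so that the endpoints are included. Continuity keeps
both curves in `N` near `t`; the two sides of `t` use forward and backward uniqueness. -/
theorem eventuallyEq_of_hasDerivWithinAt_of_lipschitzOnWith {G : Type*} [NormedAddCommGroup G]
    [NormedSpace ℝ G] {F : G → G} {f g : ℝ → G} {a b t : ℝ} (ht : t ∈ Icc a b)
    (hf : ∀ᶠ s in 𝓝[Icc a b] t, HasDerivWithinAt f (F (f s)) (Icc a b) s)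
    (hg : ∀ᶠ s in 𝓝[Icc a b] t, HasDerivWithinAt g (F (g s)) (Icc a b) s)
    (h : f t = g t) {K : ℝ≥0} {N : Set G} (hN : N ∈ 𝓝 (f t)) (hF : LipschitzOnWith K F N) :
    f =ᶠ[𝓝[Icc a b] t] g := by
  have hfN : ∀ᶠ s in 𝓝[Icc a b] t, f s ∈ N :=
    (hf.self_of_nhdsWithin ht).continuousWithinAt hN
  have hgN : ∀ᶠ s in 𝓝[Icc a b] t, g s ∈ N :=
    (hg.self_of_nhdsWithin ht).continuousWithinAt (h ▸ hN)
  obtain ⟨ε, hε, hball⟩ := Metric.mem_nhdsWithin_iff.1 (hf.and (hg.and (hfN.and hgN)))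
  refine Metric.mem_nhdsWithin_iff.2 ⟨ε, hε, fun s hs => ?_⟩
  have hs' := Real.ball_eq_Ioo t ε ▸ hs.1
  rcases le_total t s with hts | hst
  · have key : ∀ u ∈ Icc t s, u ∈ Metric.ball t ε ∩ Icc a b := fun u hu =>
      ⟨by rw [Real.ball_eq_Ioo]; exact ⟨by linarith [hu.1], hu.2.trans_lt hs'.2⟩,
        ht.1.trans hu.1, hu.2.trans hs.2.2⟩
    have hsub : Icc t s ⊆ Icc a b := fun u hu => (key u hu).2
    refine ODE_solution_unique_of_mem_Icc_right (v := fun _ => F) (s := fun _ => N) (K := K)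
      (fun _ _ => hF) (fun u hu => ((hball (key u hu)).1.continuousWithinAt).mono hsub)
      (fun u hu => (hball (key u (Ico_subset_Icc_self hu))).1.mono_of_mem_nhdsWithin ?_)
      (fun u hu => (hball (key u (Ico_subset_Icc_self hu))).2.2.1)
      (fun u hu => ((hball (key u hu)).2.1.continuousWithinAt).mono hsub)
      (fun u hu => (hball (key u (Ico_subset_Icc_self hu))).2.1.mono_of_mem_nhdsWithin ?_)
      (fun u hu => (hball (key u (Ico_subset_Icc_self hu))).2.2.2) h ⟨hts, le_rfl⟩
    all_goals exact Icc_mem_nhdsGE_of_mem ⟨ht.1.trans hu.1, hu.2.trans_le hs.2.2⟩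
  · have key : ∀ u ∈ Icc s t, u ∈ Metric.ball t ε ∩ Icc a b := fun u hu =>
      ⟨by rw [Real.ball_eq_Ioo]; exact ⟨hs'.1.trans_le hu.1, by linarith [hu.2]⟩,
        hs.2.1.trans hu.1, hu.2.trans ht.2⟩
    have hsub : Icc s t ⊆ Icc a b := fun u hu => (key u hu).2
    refine ODE_solution_unique_of_mem_Icc_left (v := fun _ => F) (s := fun _ => N) (K := K)
      (fun _ _ => hF) (fun u hu => ((hball (key u hu)).1.continuousWithinAt).mono hsub)
      (fun u hu => (hball (key u (Ioc_subset_Icc_self hu))).1.mono_of_mem_nhdsWithin ?_)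
      (fun u hu => (hball (key u (Ioc_subset_Icc_self hu))).2.2.1)
      (fun u hu => ((hball (key u hu)).2.1.continuousWithinAt).mono hsub)
      (fun u hu => (hball (key u (Ioc_subset_Icc_self hu))).2.1.mono_of_mem_nhdsWithin ?_)
      (fun u hu => (hball (key u (Ioc_subset_Icc_self hu))).2.2.2) h ⟨le_rfl, hst⟩
    all_goals exact Icc_mem_nhdsLE_of_mem ⟨hs.2.1.trans_lt hu.1, hu.2.trans ht.2⟩

namespace LipschitzSpray

variable {n : ℕ} {M : Type*} [TopologicalSpace M] [ChartedSpace (EuclideanSpace ℝ (Fin n)) M]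
  {S : LipschitzSpray n M} {e : OpenPartialHomeomorph M (EuclideanSpace ℝ (Fin n))}
  {c c' : ℝ → TangentBundle (𝓡 n) M} {J : Set ℝ}

/-- A solution of the equations of the spray in one chart is a solution on the manifold. -/
theorem isSolutionOn_tangentOf (he : e ∈ c21Charts n M)
    {x v : ℝ → EuclideanSpace ℝ (Fin n)} (h : SolvesOn (S.H e) x v J)
    (hx : ∀ t ∈ J, x t ∈ e.target) : S.IsSolutionOn (fun t => tangentOf e (x t, v t)) J := by
  refine ⟨e.continuousOn_symm.comp h.continuousOn_fst hx, ?_⟩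
  intro e' he' t ht hte'
  set φ := e.symm ≫ₕ e' with hφ
  have hsrc : x t ∈ φ.source := by
    rw [hφ, OpenPartialHomeomorph.trans_source]
    exact ⟨hx t ht, hte'⟩
  have hev : ∀ᶠ s in 𝓝[J] t, x s ∈ φ.source :=
    (h.continuousOn_fst t ht) (φ.open_source.mem_nhds hsrc)
  have hvel : ∀ s ∈ J, x s ∈ φ.source →
      velocityIn e' (tangentOf e (x s, v s)) = fderiv ℝ φ (x s) (v s) := by
    intro s hs hs'
    rw [hφ, OpenPartialHomeomorph.trans_source] at hs'
    have := velocityIn_transition he he' (w := tangentOf e (x s, v s)) (e.map_target hs'.1) hs'.2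
    rw [velocityIn_tangentOf he (z := (x s, v s)) hs'.1, tangentOf_proj, e.right_inv hs'.1] at this
    exact this
  have h1 := (differentiableAt_transition he he' hsrc).hasFDerivAt
  have h2 := ((contDiffAt_fderiv_transition he he' hsrc).differentiableAt (by norm_num)).hasFDerivAt
  obtain ⟨hxd, hvd⟩ := h t ht
  have hHe' : S.H e' (e' (e.symm (x t))) (fderiv ℝ φ (x t) (v t)) =
      fderiv ℝ (fderiv ℝ φ) (x t) (v t) (v t) + fderiv ℝ φ (x t) (S.H e (x t) (v t)) :=
    S.transform e he e' he' (x t) hsrc (v t)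
  refine ⟨?_, ?_⟩
  · rw [hvel t ht hsrc]
    exact h1.comp_hasDerivWithinAt t hxd
  · rw [hvel t ht hsrc, tangentOf_proj, hHe']
    -- The product rule for `Dφ(x) v` reproduces exactly the transformation law of the spray.
    have h3 : HasDerivWithinAt (fun s => fderiv ℝ φ (x s) (v s))
        (fderiv ℝ (fderiv ℝ φ) (x t) (v t) (v t) + fderiv ℝ φ (x t) (S.H e (x t) (v t))) J t :=
      (h2.comp_hasDerivWithinAt t hxd).clm_apply hvd
    refine h3.congr_of_eventuallyEq ?_ (hvel t ht hsrc)
    filter_upwards [hev, self_mem_nhdsWithin] with s hs hsJ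
    exact hvel s hsJ hs

theorem IsSolutionOn.solvesOn (he : e ∈ c21Charts n M) (h : S.IsSolutionOn c J)
    (hJ : ∀ t ∈ J, (c t).proj ∈ e.source) :
    SolvesOn (S.H e) (fun t => e (c t).proj) (fun t => velocityIn e (c t)) J :=
  fun t ht => h.2 e he t ht (hJ t ht)

theorem exists_lipschitzOnWith_system (he : e ∈ c21Charts n M)
    {z : EuclideanSpace ℝ (Fin n) × EuclideanSpace ℝ (Fin n)} (hz : z.1 ∈ e.target) :
    ∃ K : ℝ≥0, ∃ N ∈ 𝓝 z, LipschitzOnWith K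
      (fun z : EuclideanSpace ℝ (Fin n) × EuclideanSpace ℝ (Fin n) => (z.2, S.H e z.1 z.2)) N := by
  obtain ⟨K, N, hN, hK⟩ := S.locallyLipschitz e he (x := z) ⟨hz, mem_univ _⟩
  rw [(e.open_target.prod isOpen_univ).nhdsWithin_eq ⟨hz, mem_univ _⟩] at hN
  exact ⟨max 1 K, N, hN, (LipschitzWith.prod_snd.lipschitzOnWith).prodMk hK⟩

variable [IsC21Manifold n M] [T2Space M]

/-- Two solutions on an interval that agree at one time are equal. -/
theorem IsSolutionOn.eqOn {a b t₀ : ℝ} (h : S.IsSolutionOn c (Icc a b))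
    (h' : S.IsSolutionOn c' (Icc a b)) (ht₀ : t₀ ∈ Icc a b) (h0 : c t₀ = c' t₀) :
    EqOn c c' (Icc a b) := by
  have hvc : ∀ {d : ℝ → TangentBundle (𝓡 n) M}, S.IsSolutionOn d (Icc a b) → ∀ t ∈ Icc a b,
      ∀ e ∈ c21Charts n M, (d t).proj ∈ e.source →
      ContinuousWithinAt (fun s => velocityIn e (d s)) (Icc a b) t :=
    fun hd t ht e he hte => (hd.2 e he t ht hte).2.continuousWithinAt
  -- The coincidence set is nonempty and clopen in a connected interval. It is closed because
  -- positions have unique limits in the Hausdorff space `M`, and then so do velocities in a chart;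
  -- it is open by local uniqueness.
  let A : Set (Icc a b) := {t | c t = c' t}
  have hclosed : IsClosed A := by
    refine isClosed_of_closure_subset fun t ht => ?_
    have : (𝓝[A] t).NeBot := mem_closure_iff_nhdsWithin_neBot.1 ht
    have hval : Tendsto (Subtype.val : Icc a b → ℝ) (𝓝[A] t) (𝓝[Icc a b] (t : ℝ)) :=
      tendsto_nhdsWithin_iff.2 ⟨continuous_subtype_val.continuousAt.mono_left nhdsWithin_le_nhds,
        Eventually.of_forall fun s => s.2⟩
    have hp : (c t).proj = (c' t).proj := by
      refine tendsto_nhds_unique_of_eventuallyEq ((h.1 t t.2).tendsto.comp hval)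
        ((h'.1 t t.2).tendsto.comp hval) ?_
      filter_upwards [self_mem_nhdsWithin] with s hs
      exact congrArg _ hs
    have he := chartAt_mem_c21Charts (n := n) (c t).proj
    have hsrc := mem_chart_source (EuclideanSpace ℝ (Fin n)) (c t).proj
    refine eq_of_velocityIn_eq he hsrc hp ?_
    refine tendsto_nhds_unique_of_eventuallyEq ((hvc h t t.2 _ he hsrc).tendsto.comp hval)
      ((hvc h' t t.2 _ he (hp ▸ hsrc)).tendsto.comp hval) ?_
    filter_upwards [self_mem_nhdsWithin] with s hs
    exact congrArg _ hs
  have hopen : IsOpen A := by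
    refine isOpen_iff_mem_nhds.2 fun t ht => ?_
    have htA : c t = c' t := ht
    have he := chartAt_mem_c21Charts (n := n) (c t).proj
    have hsrc := mem_chart_source (EuclideanSpace ℝ (Fin n)) (c t).proj
    set e := chartAt (EuclideanSpace ℝ (Fin n)) (c t).proj
    have hloc : ∀ {d : ℝ → TangentBundle (𝓡 n) M}, S.IsSolutionOn d (Icc a b) →
        (d t).proj ∈ e.source → ∀ᶠ s in 𝓝[Icc a b] (t : ℝ), (d s).proj ∈ e.source ∧
          HasDerivWithinAt (fun s => (e (d s).proj, velocityIn e (d s)))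
            ((fun z : EuclideanSpace ℝ (Fin n) × EuclideanSpace ℝ (Fin n) => (z.2, S.H e z.1 z.2))
              (e (d s).proj, velocityIn e (d s))) (Icc a b) s := by
      intro d hd hdt
      filter_upwards [(hd.1 t t.2) (e.open_source.mem_nhds hdt), self_mem_nhdsWithin] with s hs hsJ
      exact ⟨hs, (hd.2 e he s hsJ hs).1.prodMk (hd.2 e he s hsJ hs).2⟩
    have h1 := hloc h hsrc
    have h2 := hloc h' (htA ▸ hsrc)
    obtain ⟨K, N, hN, hK⟩ := exists_lipschitzOnWith_system (S := S) he
      (z := (e (c t).proj, velocityIn e (c t))) (e.map_source hsrc)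
    have h3 := eventuallyEq_of_hasDerivWithinAt_of_lipschitzOnWith t.2 (h1.mono fun _ h => h.2)
      (h2.mono fun _ h => h.2) (by rw [htA]) hN hK
    have h4 : ∀ᶠ s in 𝓝[Icc a b] (t : ℝ), c s = c' s := by
      filter_upwards [h1, h2, h3] with s hs1 hs2 hs3
      obtain ⟨hs3, hs4⟩ := Prod.mk.inj hs3
      exact eq_of_velocityIn_eq he hs1.1 (e.injOn hs1.1 hs2.1 hs3) hs4
    exact (eventually_nhds_subtype_iff (Icc a b) t (fun s => c s = c' s)).2 h4
  have : PreconnectedSpace (Icc a b) := Subtype.preconnectedSpace isPreconnected_Icc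
  have hA : A = univ := IsClopen.eq_univ ⟨hclosed, hopen⟩ ⟨⟨t₀, ht₀⟩, h0⟩
  intro t ht
  have : (⟨t, ht⟩ : Icc a b) ∈ A := hA ▸ mem_univ _
  exact this

/-- By uniqueness, the solution chosen in `point` is irrelevant. -/
theorem IsSolutionOn.point_eq {τ : ℝ} (h : S.IsSolutionOn c (uIcc 0 τ)) :
    S.point τ (c 0) = (c τ).proj := by
  have hd : c 0 ∈ S.domain τ := ⟨c, h, rfl⟩
  rw [point, dif_pos hd]
  have hs := hd.choose_spec
  exact congrArg _ (IsSolutionOn.eqOn hs.1 h left_mem_uIcc hs.2 right_mem_uIcc)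

end LipschitzSpray

/-! ### Bi-Lipschitz bounds and the exponential map on the square of a ball -/

namespace IsExpFlow

variable {E : Type*} [NormedAddCommGroup E] [NormedSpace ℝ E] {H : E → E → E} {p : E}
  {R ρ δ₀ : ℝ} {X V : E → E → ℝ → E}

theorem apply_zero (h : IsExpFlow H p R ρ δ₀ X V) {q : E} (hq : q ∈ Metric.closedBall p δ₀) :
    X q 0 1 = q := by
  have h0 : ‖(0 : E)‖ ≤ ρ := by rw [norm_zero]; exact h.speed_pos.le
  have := h.scale q hq 0 h0 0 (by simp)
  rw [smul_zero] at this
  rw [this, h.fst_zero q hq 0 h0]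

theorem norm_sub_le (h : IsExpFlow H p R ρ δ₀ X V) {q w q' w' : E}
    (hq : q ∈ Metric.closedBall p δ₀) (hw : ‖w‖ ≤ ρ) (hq' : q' ∈ Metric.closedBall p δ₀)
    (hw' : ‖w'‖ ≤ ρ) : ‖X q w 1 - X q' w' 1‖ ≤ 5 * max ‖q - q'‖ ‖w - w'‖ := by
  have h1 := h.approx q hq w hw q' hq' w' hw'
  have h2 : ‖X q w 1 - X q' w' 1‖ ≤
      ‖X q w 1 - X q' w' 1 - (q - q') - (w - w')‖ + ‖q - q'‖ + ‖w - w'‖ := by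
    have : X q w 1 - X q' w' 1 = (X q w 1 - X q' w' 1 - (q - q') - (w - w')) + (q - q') +
      (w - w') := by abel
    conv_lhs => rw [this]
    exact norm_add₃_le
  have := le_max_left ‖q - q'‖ ‖w - w'‖
  have := le_max_right ‖q - q'‖ ‖w - w'‖
  linarith [norm_nonneg (q - q'), norm_nonneg (w - w')]

/-- The error in `approx` is at most half of `‖q - q'‖ + ‖w - w'‖`. Absorbing `‖w - w'‖ / 2` on the
left leaves twice the distance of the endpoints plus `3‖q - q'‖`, whence 5. Equal base points and
endpoints force equal velocities. -/
theorem norm_velocity_sub_le (h : IsExpFlow H p R ρ δ₀ X V) {q w q' w' : E}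
    (hq : q ∈ Metric.closedBall p δ₀) (hw : ‖w‖ ≤ ρ) (hq' : q' ∈ Metric.closedBall p δ₀)
    (hw' : ‖w'‖ ≤ ρ) : ‖w - w'‖ ≤ 5 * max ‖q - q'‖ ‖X q w 1 - X q' w' 1‖ := by
  have h1 := h.approx q hq w hw q' hq' w' hw'
  have h2 : ‖w - w'‖ ≤
      ‖X q w 1 - X q' w' 1‖ + ‖q - q'‖ + ‖X q w 1 - X q' w' 1 - (q - q') - (w - w')‖ := by
    have : w - w' = (X q w 1 - X q' w' 1) - (q - q') -
      (X q w 1 - X q' w' 1 - (q - q') - (w - w')) := by abel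
    conv_lhs => rw [this]
    exact (_root_.norm_sub_le _ _).trans (add_le_add_left (_root_.norm_sub_le _ _) _)
  have h3 := max_le_add_of_nonneg (norm_nonneg (q - q')) (norm_nonneg (w - w'))
  have := le_max_left ‖q - q'‖ ‖X q w 1 - X q' w' 1‖
  have := le_max_right ‖q - q'‖ ‖X q w 1 - X q' w' 1‖
  linarith [norm_nonneg (q - q'), norm_nonneg (w - w')]

theorem isOpen_preimage (h : IsExpFlow H p R ρ δ₀ X V) {δ : ℝ} (hδ : δ < δ₀) :
    IsOpen {z : E × E | (z.1 ∈ Metric.ball p δ ∧ ‖z.2‖ < ρ) ∧ X z.1 z.2 1 ∈ Metric.ball p δ} := by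
  have ho : IsOpen {z : E × E | z.1 ∈ Metric.ball p δ ∧ ‖z.2‖ < ρ} :=
    (Metric.isOpen_ball.preimage continuous_fst).inter
      (isOpen_lt continuous_snd.norm continuous_const)
  have hb : Metric.ball p δ ⊆ Metric.closedBall p δ₀ :=
    Metric.ball_subset_closedBall.trans (Metric.closedBall_subset_closedBall hδ.le)
  have hc : ContinuousOn (fun z : E × E => X z.1 z.2 1)
      {z : E × E | z.1 ∈ Metric.ball p δ ∧ ‖z.2‖ < ρ} := by
    refine LipschitzOnWith.continuousOn (K := 5) (LipschitzOnWith.of_dist_le_mul ?_)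
    intro z hz y hy
    rw [dist_eq_norm, dist_eq_norm]
    exact h.norm_sub_le (hb hz.1) hz.2.le (hb hy.1) hy.2.le
  exact hc.isOpen_inter_preimage ho Metric.isOpen_ball

end IsExpFlow

section

variable {n : ℕ} {M : Type*} [TopologicalSpace M] [ChartedSpace (EuclideanSpace ℝ (Fin n)) M]
  [IsC21Manifold n M] {e : OpenPartialHomeomorph M (EuclideanSpace ℝ (Fin n))} {p : M}
  {H : EuclideanSpace ℝ (Fin n) → EuclideanSpace ℝ (Fin n) → EuclideanSpace ℝ (Fin n)}
  {R ρ δ₀ δ : ℝ} {X V : EuclideanSpace ℝ (Fin n) → EuclideanSpace ℝ (Fin n) → ℝ →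
    EuclideanSpace ℝ (Fin n)}

theorem mem_image_symm_iff {X Y : Type*} [TopologicalSpace X] [TopologicalSpace Y]
    {e : OpenPartialHomeomorph X Y} {s : Set Y} (hs : s ⊆ e.target) {x : X} :
    x ∈ e.symm '' s ↔ x ∈ e.source ∧ e x ∈ s := by
  constructor
  · rintro ⟨y, hy, rfl⟩
    exact ⟨e.map_target (hs hy), by rwa [e.right_inv (hs hy)]⟩
  · rintro ⟨h1, h2⟩
    exact ⟨e x, h2, e.left_inv h1⟩

/-- A map that in a chart is `(x, v) ↦ (x, X x (± v) 1)` is a Lipeomorphism of an open star-shaped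
set onto the square of the coordinate ball. -/
theorem IsExpFlow.exists_isLipeoOn (h : IsExpFlow H (e p) R ρ δ₀ X V) (he : e ∈ c21Charts n M)
    (hδ : δ < δ₀) (htarget : Metric.ball (e p) δ ⊆ e.target) {σ : ℝ} (hσ : ‖σ‖ = 1)
    {f : TangentBundle (𝓡 n) M → M × M}
    (hf : ∀ w : TangentBundle (𝓡 n) M, w.proj ∈ e.source →
      e w.proj ∈ Metric.ball (e p) δ → ‖velocityIn e w‖ < ρ →
      f w = (w.proj, e.symm (X (e w.proj) (σ • velocityIn e w) 1))) :
    ∃ W : Set (TangentBundle (𝓡 n) M), IsOpen W ∧ IsStarShaped W ∧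
      (∀ w ∈ W, w.proj ∈ e.symm '' Metric.ball (e p) δ) ∧
      (∀ w ∈ W, w.proj ∈ e.source ∧ e w.proj ∈ Metric.ball (e p) δ ∧ ‖velocityIn e w‖ < ρ) ∧
      IsLipeoOn (𝓡 n).tangent ((𝓡 n).prod (𝓡 n)) f W
        ((e.symm '' Metric.ball (e p) δ) ×ˢ (e.symm '' Metric.ball (e p) δ)) := by
  have hb : Metric.ball (e p) δ ⊆ Metric.closedBall (e p) δ₀ :=
    Metric.ball_subset_closedBall.trans (Metric.closedBall_subset_closedBall hδ.le)
  have hσn : ∀ u : EuclideanSpace ℝ (Fin n), ‖σ • u‖ = ‖u‖ := fun u => by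
    rw [norm_smul, hσ, one_mul]
  have hσσ : ∀ u : EuclideanSpace ℝ (Fin n), σ • σ • u = u := fun u => by
    rw [smul_smul, ← pow_two, ← sq_abs, ← Real.norm_eq_abs, hσ, one_pow, one_smul]
  have hT := isLipCoord_tangent (n := n) (M := M) he
  have hT' := (isLipCoord_chart (n := n) (M := M) he).prodMap (isLipCoord_chart he)
  set T : TangentBundle (𝓡 n) M → _ := fun w => (e w.proj, velocityIn e w) with hTdef
  have hproj : Continuous (Bundle.TotalSpace.proj : TangentBundle (𝓡 n) M → M) :=
    FiberBundle.continuous_proj _ _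
  -- Slow vectors whose geodesic ends in the ball; `σ = 1` serves `exp` and `σ = -1` serves
  -- `revExp`.
  let Ω : Set (EuclideanSpace ℝ (Fin n) × EuclideanSpace ℝ (Fin n)) :=
    {z | (z.1 ∈ Metric.ball (e p) δ ∧ ‖σ • z.2‖ < ρ) ∧ X z.1 (σ • z.2) 1 ∈ Metric.ball (e p) δ}
  have hΩ : IsOpen Ω := (h.isOpen_preimage hδ).preimage
    (f := fun z : EuclideanSpace ℝ (Fin n) × EuclideanSpace ℝ (Fin n) => (z.1, σ • z.2))
    (by fun_prop)
  let W : Set (TangentBundle (𝓡 n) M) := Bundle.TotalSpace.proj ⁻¹' e.source ∩ T ⁻¹' Ω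
  have hWo : IsOpen W := ContinuousOn.isOpen_inter_preimage
    (fun w hw => (hT.continuousAt hw).continuousWithinAt) (e.open_source.preimage hproj) hΩ
  have hWm : ∀ w ∈ W, w.proj ∈ e.source ∧ e w.proj ∈ Metric.ball (e p) δ ∧
      ‖velocityIn e w‖ < ρ := fun w hw => ⟨hw.1, hw.2.1.1, by rw [← hσn]; exact hw.2.1.2⟩
  have hfW : ∀ w ∈ W, f w = (w.proj, e.symm (X (e w.proj) (σ • velocityIn e w) 1)) :=
    fun w hw => hf w (hWm w hw).1 (hWm w hw).2.1 (hWm w hw).2.2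
  have hC : e.symm '' Metric.ball (e p) δ ⊆ e.source := fun x hx =>
    ((mem_image_symm_iff htarget).1 hx).1
  have hWC : ∀ w ∈ W, w.proj ∈ e.symm '' Metric.ball (e p) δ := fun w hw =>
    (mem_image_symm_iff htarget).2 ⟨(hWm w hw).1, (hWm w hw).2.1⟩
  have hTf : ∀ w ∈ W, Prod.map e e (f w) =
      (e w.proj, X (e w.proj) (σ • velocityIn e w) 1) := fun w hw => by
    rw [hfW w hw, Prod.map_apply, e.right_inv (htarget hw.2.2)]
  refine ⟨W, hWo, ?_, hWC, hWm, ?_⟩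
  · intro w hw s hs
    have hv : velocityIn e (⟨w.proj, s • w.2⟩ : TangentBundle (𝓡 n) M) = s • velocityIn e w :=
      velocityIn_smul w.proj w.2 s
    have hle : ‖σ • velocityIn e w‖ ≤ ρ := hw.2.1.2.le
    refine ⟨hw.1, ⟨hw.2.1.1, ?_⟩, ?_⟩
    · change ‖σ • velocityIn e (⟨w.proj, s • w.2⟩ : TangentBundle (𝓡 n) M)‖ < ρ
      rw [hv, hσn, norm_smul, Real.norm_of_nonneg hs.1]
      exact (mul_le_of_le_one_left (norm_nonneg _) hs.2).trans_lt (hWm w hw).2.2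
    · change X (e w.proj) (σ • velocityIn e (⟨w.proj, s • w.2⟩ : TangentBundle (𝓡 n) M)) 1 ∈ _
      -- Shrinking the vector by `s` moves the endpoint back to time `s` of the same geodesic, which
      -- remains in the ball by convexity.
      rw [hv, smul_comm, h.scale _ (hb hw.2.1.1) _ hle s hs]
      exact h.convex _ (hb hw.2.1.1) _ hle _ hw.2.1.1 hw.2.2 s hs
  · have : Nonempty (TangentBundle (𝓡 n) M) := ⟨⟨p, (0 : EuclideanSpace ℝ (Fin n))⟩⟩
    refine hT.isLipeoOn hT' (fun w hw => hw.1) (prod_mono hC hC) ?_ ?_ (C := 5) ?_ ?_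
    · intro w hw
      rw [hfW w hw]
      exact ⟨hWC w hw, mem_image_of_mem _ hw.2.2⟩
    · rintro ⟨q, r⟩ ⟨hq, hr⟩
      rw [mem_image_symm_iff htarget] at hq hr
      obtain ⟨u, hu, hur⟩ := h.surj _ (hb hq.2) _ (hb hr.2)
      have h1 : (tangentOf e (e q, σ • u)).proj = q := e.left_inv hq.1
      have h2 : velocityIn e (tangentOf e (e q, σ • u)) = σ • u :=
        velocityIn_tangentOf he (z := (e q, σ • u)) (e.map_source hq.1)
      have hW : tangentOf e (e q, σ • u) ∈ W := by
        refine ⟨by rw [mem_preimage, h1]; exact hq.1, ?_⟩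
        change T (tangentOf e (e q, σ • u)) ∈ Ω
        simp only [hTdef]
        rw [h1, h2]
        refine ⟨⟨hq.2, ?_⟩, ?_⟩
        · change ‖σ • σ • u‖ < ρ
          rwa [hσσ]
        · change X (e q) (σ • σ • u) 1 ∈ _
          rw [hσσ, hur]; exact hr.2
      refine ⟨_, hW, ?_⟩
      rw [hfW _ hW, h1, h2, hσσ, hur, e.left_inv hr.1]
    · intro y hy z hz
      rw [hTf y hy, hTf z hz]
      have := h.norm_sub_le (hb hy.2.1.1) hy.2.1.2.le (hb hz.2.1.1) hz.2.1.2.le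
      simp only [hTdef] at this ⊢
      rw [← smul_sub, hσn] at this
      rw [Prod.mk_sub_mk, Prod.mk_sub_mk, Prod.norm_mk, Prod.norm_mk]
      refine max_le ((le_max_left _ _).trans (le_mul_of_one_le_left (by positivity) ?_)) this
      norm_num
    · intro y hy z hz
      rw [hTf y hy, hTf z hz]
      have := h.norm_velocity_sub_le (hb hy.2.1.1) hy.2.1.2.le (hb hz.2.1.1) hz.2.1.2.le
      simp only [hTdef] at this ⊢
      rw [← smul_sub, hσn] at this
      rw [Prod.mk_sub_mk, Prod.mk_sub_mk, Prod.norm_mk, Prod.norm_mk]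
      refine max_le ((le_max_left _ _).trans (le_mul_of_one_le_left (by positivity) ?_)) this
      norm_num

end

/-! ### Coordinate balls are strictly convex normal -/

namespace LipschitzSpray

variable {n : ℕ} {M : Type*} [TopologicalSpace M] [ChartedSpace (EuclideanSpace ℝ (Fin n)) M]
  {S : LipschitzSpray n M} {e : OpenPartialHomeomorph M (EuclideanSpace ℝ (Fin n))} {p : M}
  {R ρ δ₀ δ : ℝ} {X V : EuclideanSpace ℝ (Fin n) → EuclideanSpace ℝ (Fin n) → ℝ →
    EuclideanSpace ℝ (Fin n)}

theorem isSolutionOn_flow (h : IsExpFlow (S.H e) (e p) R ρ δ₀ X V) (he : e ∈ c21Charts n M)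
    (hR : Metric.ball (e p) R ⊆ e.target) {w : TangentBundle (𝓡 n) M} (hw : w.proj ∈ e.source)
    (hwδ : e w.proj ∈ Metric.closedBall (e p) δ₀) (hwρ : ‖velocityIn e w‖ ≤ ρ) :
    S.IsSolutionOn (fun t => tangentOf e
      (X (e w.proj) (velocityIn e w) t, V (e w.proj) (velocityIn e w) t)) (Icc 0 1) ∧
    tangentOf e
      (X (e w.proj) (velocityIn e w) 0, V (e w.proj) (velocityIn e w) 0) = w := by
  refine ⟨isSolutionOn_tangentOf he (h.solvesOn _ hwδ _ hwρ)
    fun t ht => hR (h.mem_ball _ hwδ _ hwρ t ht), ?_⟩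
  rw [h.fst_zero _ hwδ _ hwρ, h.snd_zero _ hwδ _ hwρ, tangentOf_velocityIn he hw]

theorem exists_isSprayOnBall (S : LipschitzSpray n M) (he : e ∈ c21Charts n M) (hp : p ∈ e.source)
    {U : Set (EuclideanSpace ℝ (Fin n))} (hU : U ∈ 𝓝 (e p)) :
    ∃ R K, Metric.ball (e p) R ⊆ U ∩ e.target ∧ IsSprayOnBall (S.H e) (e p) R K := by
  have hpt := e.map_source hp
  obtain ⟨k, t, ht, hk⟩ := S.locallyLipschitz e he (x := (e p, 0)) ⟨hpt, mem_univ _⟩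
  rw [(e.open_target.prod isOpen_univ).nhdsWithin_eq ⟨hpt, mem_univ _⟩] at ht
  exact IsSprayOnBall.exists_of_lipschitzOnWith (inter_mem hU (e.open_target.mem_nhds hpt))
    (fun x hx v s hs => S.homogeneous e he x hx.2 v s hs) ht hk

variable [IsC21Manifold n M] [T2Space M]

theorem point_one_eq (h : IsExpFlow (S.H e) (e p) R ρ δ₀ X V) (he : e ∈ c21Charts n M)
    (hR : Metric.ball (e p) R ⊆ e.target) {w : TangentBundle (𝓡 n) M} (hw : w.proj ∈ e.source)
    (hwδ : e w.proj ∈ Metric.closedBall (e p) δ₀) (hwρ : ‖velocityIn e w‖ ≤ ρ) :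
    w ∈ S.domain 1 ∧ S.point 1 w = e.symm (X (e w.proj) (velocityIn e w) 1) := by
  obtain ⟨h1, h2⟩ := isSolutionOn_flow h he hR hw hwδ hwρ
  rw [← uIcc_of_le zero_le_one] at h1
  refine ⟨⟨_, h1, h2⟩, ?_⟩
  have := h1.point_eq
  simp only [h2] at this
  exact this

theorem point_neg_one_eq (h : IsExpFlow (S.reverse.H e) (e p) R ρ δ₀ X V) (he : e ∈ c21Charts n M)
    (hR : Metric.ball (e p) R ⊆ e.target) {w : TangentBundle (𝓡 n) M} (hw : w.proj ∈ e.source)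
    (hwδ : e w.proj ∈ Metric.closedBall (e p) δ₀) (hwρ : ‖velocityIn e w‖ ≤ ρ) :
    w ∈ S.domain (-1) ∧ S.point (-1) w = e.symm (X (e w.proj) (-velocityIn e w) 1) := by
  set q := e w.proj
  set u := velocityIn e w with hu
  have hwρ' : ‖-u‖ ≤ ρ := by rwa [norm_neg]
  have hs := h.solvesOn q hwδ (-u) hwρ'
  have hJ : uIcc (0 : ℝ) (-1) = Icc (-1) 0 := uIcc_of_ge (by norm_num)
  have hmaps : MapsTo (fun t : ℝ => -t) (Icc (-1 : ℝ) 0) (Icc 0 1) := fun t ht =>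
    ⟨by linarith [ht.2], by linarith [ht.1]⟩
  -- Time reversal: `X(-t)` has velocity `-V(-t)` and acceleration `H(X, -V)`, so it solves the
  -- equations of `S`, with initial velocity `u`.
  have hs' : SolvesOn (S.H e) (fun t => X q (-u) (-t)) (fun t => -V q (-u) (-t)) (Icc (-1) 0) := by
    intro t ht
    have hd := (hasDerivWithinAt_id t (Icc (-1 : ℝ) 0)).neg
    obtain ⟨h1, h2⟩ := hs _ (hmaps ht)
    have h3 := h1.scomp t hd hmaps
    have h4 := (h2.scomp t hd hmaps).neg
    rw [neg_one_smul] at h3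
    rw [neg_one_smul, neg_neg] at h4
    exact ⟨h3, h4⟩
  have hsol := isSolutionOn_tangentOf he hs' fun t ht =>
    hR (h.mem_ball q hwδ (-u) hwρ' (-t) (hmaps ht))
  have h0 : tangentOf e (X q (-u) (-0), -V q (-u) (-0)) = w := by
    rw [neg_zero, h.fst_zero q hwδ _ hwρ', h.snd_zero q hwδ _ hwρ', neg_neg,
      tangentOf_velocityIn he hw]
  rw [← hJ] at hsol
  refine ⟨⟨_, hsol, h0⟩, ?_⟩
  have := hsol.point_eq
  simp only [h0, neg_neg] at this
  exact this

theorem isConvexNormal_ball (h : IsExpFlow (S.H e) (e p) R ρ δ₀ X V) (he : e ∈ c21Charts n M)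
    (hR : Metric.ball (e p) R ⊆ e.target) (hδ : δ < δ₀) :
    S.IsConvexNormal (e.symm '' Metric.ball (e p) δ) := by
  have hb : Metric.ball (e p) δ ⊆ Metric.closedBall (e p) δ₀ :=
    Metric.ball_subset_closedBall.trans (Metric.closedBall_subset_closedBall hδ.le)
  have htarget : Metric.ball (e p) δ ⊆ e.target :=
    (Metric.ball_subset_ball (hδ.le.trans h.radius_lt.le)).trans hR
  have hopen : IsOpen (e.symm '' Metric.ball (e p) δ) :=
    e.isOpen_image_symm_of_subset_target Metric.isOpen_ball htarget
  refine ⟨hopen, fun q hq => ⟨hopen, hq, ?_⟩⟩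
  rw [mem_image_symm_iff htarget] at hq
  -- `L` passes from the model copy of the tangent space at `q` to components in `e`, where the flow
  -- estimates hold.
  obtain ⟨L, hL⟩ := exists_fiber_equiv he hq.1
  have hexp : ∀ v, ‖L v‖ ≤ ρ → (⟨q, v⟩ : TangentBundle (𝓡 n) M) ∈ S.domain 1 ∧
      S.expAt q v = e.symm (X (e q) (L v) 1) := fun v hv => by
    rw [hL] at hv ⊢
    exact point_one_eq h he hR (w := (⟨q, v⟩ : TangentBundle (𝓡 n) M)) hq.1 (hb hq.2) hv
  let A : Set (EuclideanSpace ℝ (Fin n)) :=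
    {v | (e q ∈ Metric.ball (e p) δ ∧ ‖L v‖ < ρ) ∧ X (e q) (L v) 1 ∈ Metric.ball (e p) δ}
  have hA : IsOpen A := (h.isOpen_preimage hδ).preimage (f := fun v => (e q, L v)) (by fun_prop)
  refine ⟨A, hA, ?_, fun v hv => (hexp v hv.1.2.le).1, ?_⟩
  · rw [starConvex_zero_iff]
    intro v hv s hs0 hs1
    have hle : ‖L v‖ ≤ ρ := hv.1.2.le
    refine ⟨⟨hq.2, ?_⟩, ?_⟩
    · rw [map_smul, norm_smul, Real.norm_of_nonneg hs0]
      exact (mul_le_of_le_one_left (norm_nonneg _) hs1).trans_lt hv.1.2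
    · rw [map_smul, h.scale _ (hb hq.2) _ hle s ⟨hs0, hs1⟩]
      exact h.convex _ (hb hq.2) _ hle _ hq.2 hv.2 s ⟨hs0, hs1⟩
  · have hef : ∀ v ∈ A, e (S.expAt q v) = X (e q) (L v) 1 := fun v hv => by
      rw [(hexp v hv.1.2.le).2, e.right_inv (htarget hv.2)]
    refine (isLipCoord_continuousLinearEquiv L).isLipeoOn (isLipCoord_chart he) (subset_univ _)
      (fun x hx => ((mem_image_symm_iff htarget).1 hx).1) ?_ ?_ (C := 5) ?_ ?_
    · intro v hv
      rw [(hexp v hv.1.2.le).2]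
      exact mem_image_of_mem _ hv.2
    · intro r hr
      rw [mem_image_symm_iff htarget] at hr
      obtain ⟨u, hu, hur⟩ := h.surj _ (hb hq.2) _ (hb hr.2)
      have hLu : L (L.symm u) = u := L.apply_symm_apply u
      refine ⟨L.symm u, ⟨⟨hq.2, by rwa [hLu]⟩, by rw [hLu, hur]; exact hr.2⟩, ?_⟩
      rw [(hexp _ (by rw [hLu]; exact hu.le)).2, hLu, hur, e.left_inv hr.1]
    · intro v hv v' hv'
      rw [hef v hv, hef v' hv']
      have := h.norm_sub_le (hb hq.2) hv.1.2.le (hb hq.2) hv'.1.2.le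
      rw [sub_self, norm_zero, max_eq_right (norm_nonneg _)] at this
      exact this
    · intro v hv v' hv'
      rw [hef v hv, hef v' hv']
      have := h.norm_velocity_sub_le (hb hq.2) hv.1.2.le (hb hq.2) hv'.1.2.le
      rw [sub_self, norm_zero, max_eq_right (norm_nonneg _)] at this
      exact this

theorem isStrictlyConvexNormal_ball (h : IsExpFlow (S.H e) (e p) R ρ δ₀ X V)
    (he : e ∈ c21Charts n M) (hR : Metric.ball (e p) R ⊆ e.target) (hδ : δ < δ₀) :
    S.IsStrictlyConvexNormal (e.symm '' Metric.ball (e p) δ) := by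
  have hb : Metric.closedBall (e p) δ ⊆ Metric.closedBall (e p) δ₀ :=
    Metric.closedBall_subset_closedBall hδ.le
  have htarget : Metric.closedBall (e p) δ ⊆ e.target :=
    (hb.trans (Metric.closedBall_subset_ball h.radius_lt)).trans hR
  have hbt : Metric.ball (e p) δ ⊆ e.target := Metric.ball_subset_closedBall.trans htarget
  -- The image is compact and `M` is Hausdorff; hence the closure of the coordinate ball does not
  -- leave the chart.
  have hclosed : IsClosed (e.symm '' Metric.closedBall (e p) δ) :=
    ((isCompact_closedBall _ _).image_of_continuousOn (e.continuousOn_symm.mono htarget)).isClosed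
  have hcl : ∀ q ∈ closure (e.symm '' Metric.ball (e p) δ),
      q ∈ e.source ∧ e q ∈ Metric.closedBall (e p) δ := fun q hq =>
    (mem_image_symm_iff htarget).1
      (closure_minimal (image_mono Metric.ball_subset_closedBall) hclosed hq)
  refine ⟨isConvexNormal_ball h he hR hδ, fun q hq r hr hqr => ?_⟩
  replace hq := hcl q hq
  replace hr := hcl r hr
  obtain ⟨u, hu, hur⟩ := h.surj _ (hb hq.2) _ (hb hr.2)
  have hu0 : u ≠ 0 := by
    rintro rfl
    rw [h.apply_zero (hb hq.2)] at hur
    exact hqr (e.injOn hq.1 hr.1 hur)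
  have hxt : ∀ t ∈ Icc (0 : ℝ) 1, X (e q) u t ∈ e.target := fun t ht =>
    hR (h.mem_ball _ (hb hq.2) _ hu.le t ht)
  have hsol := isSolutionOn_tangentOf he (h.solvesOn _ (hb hq.2) _ hu.le) hxt
  refine ⟨fun t => tangentOf e (X (e q) u t, V (e q) u t), ⟨⟨hsol, ?_⟩, ?_, ?_, ?_⟩, ?_⟩
  · intro t ht h0
    rw [← velocityIn_eq_zero_iff he (e.map_target (hxt t ht)),
      velocityIn_tangentOf he (z := (X (e q) u t, V (e q) u t)) (hxt t ht)] at h0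
    exact h.snd_ne_zero _ (hb hq.2) _ hu.le hu0 t ht h0
  · rw [tangentOf_proj, h.fst_zero _ (hb hq.2) _ hu.le, e.left_inv hq.1]
  · rw [tangentOf_proj, hur, e.left_inv hr.1]
  · intro t ht
    exact mem_image_of_mem _
      (h.strictConvex _ (hb hq.2) _ hu.le hu0 δ hq.2 (by rw [hur]; exact hr.2) t ht)
  · rintro c' ⟨⟨hc', -⟩, hc0, hc1, hcC⟩
    have hmem : ∀ t ∈ Icc (0 : ℝ) 1, (c' t).proj ∈ e.source ∧
        e (c' t).proj ∈ Metric.closedBall (e p) δ := by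
      intro t ht
      rcases ht.1.eq_or_lt with rfl | h0
      · rw [hc0]; exact hq
      rcases ht.2.eq_or_lt with rfl | h1
      · rw [hc1]; exact hr
      obtain ⟨h2, h3⟩ := (mem_image_symm_iff hbt).1 (hcC t ⟨h0, h1⟩)
      exact ⟨h2, Metric.ball_subset_closedBall h3⟩
    -- A competitor is not assumed slow; its confinement to the closed ball makes it so, and it is
    -- then one of the curves of the flow.
    have hsmall : ‖velocityIn e (c' 0)‖ < ρ :=
      h.small (fun t => e (c' t).proj) (fun t => velocityIn e (c' t))
        (hc'.solvesOn he fun t ht => (hmem t ht).1) fun t ht => hb (hmem t ht).2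
    have h0m : (0 : ℝ) ∈ Icc (0 : ℝ) 1 := by simp
    obtain ⟨h1, h2⟩ := isSolutionOn_flow h he hR (w := c' 0) (hmem 0 h0m).1
      (hb (hmem 0 h0m).2) hsmall.le
    have heq := hc'.eqOn h1 h0m h2.symm
    have h3 := congrArg (fun w => e (Bundle.TotalSpace.proj w)) (heq (right_mem_Icc.2 zero_le_one))
    have h4 : X (e q) (velocityIn e (c' 0)) 1 ∈ e.target := by
      have := h.mem_ball _ (hb hq.2) _ hsmall.le 1 (right_mem_Icc.2 zero_le_one)
      exact hR this
    simp only [tangentOf_proj, hc0, hc1] at h3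
    rw [e.right_inv h4, ← hur] at h3
    -- Both geodesics join the same two points, so injectivity identifies their initial velocities.
    have h5 := h.norm_velocity_sub_le (hb hq.2) hu.le (hb hq.2) hsmall.le
    rw [← h3, sub_self, sub_self, norm_zero, max_self, mul_zero] at h5
    have h6 : u = velocityIn e (c' 0) := sub_eq_zero.1 (norm_le_zero_iff.1 h5)
    simp only [hc0, ← h6] at heq
    exact heq

theorem expIsLipeo_ball (h : IsExpFlow (S.H e) (e p) R ρ δ₀ X V)
    (he : e ∈ c21Charts n M) (hR : Metric.ball (e p) R ⊆ e.target) (hδ : δ < δ₀) :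
    S.ExpIsLipeo (e.symm '' Metric.ball (e p) δ) := by
  have hb : Metric.ball (e p) δ ⊆ Metric.closedBall (e p) δ₀ :=
    Metric.ball_subset_closedBall.trans (Metric.closedBall_subset_closedBall hδ.le)
  have hbt : Metric.ball (e p) δ ⊆ e.target :=
    (hb.trans (Metric.closedBall_subset_ball h.radius_lt)).trans hR
  obtain ⟨W, h1, h2, h3, h4, h5⟩ := h.exists_isLipeoOn he hδ hbt (σ := 1) (f := S.exp) (by simp)
    fun w hw hwδ hwρ => by
      rw [one_smul, exp, (point_one_eq h he hR hw (hb hwδ) hwρ.le).2]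
  exact ⟨W, h1, h2, h3, fun w hw =>
    (point_one_eq h he hR (h4 w hw).1 (hb (h4 w hw).2.1) (h4 w hw).2.2.le).1, h5⟩

theorem revExpIsLipeo_ball (h : IsExpFlow (S.reverse.H e) (e p) R ρ δ₀ X V)
    (he : e ∈ c21Charts n M) (hR : Metric.ball (e p) R ⊆ e.target) (hδ : δ < δ₀) :
    S.RevExpIsLipeo (e.symm '' Metric.ball (e p) δ) := by
  have hb : Metric.ball (e p) δ ⊆ Metric.closedBall (e p) δ₀ :=
    Metric.ball_subset_closedBall.trans (Metric.closedBall_subset_closedBall hδ.le)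
  have hbt : Metric.ball (e p) δ ⊆ e.target :=
    (hb.trans (Metric.closedBall_subset_ball h.radius_lt)).trans hR
  obtain ⟨W, h1, h2, h3, h4, h5⟩ := h.exists_isLipeoOn he hδ hbt (σ := -1) (f := S.revExp) (by simp)
    fun w hw hwδ hwρ => by
      rw [neg_one_smul, revExp, (point_neg_one_eq h he hR hw (hb hwδ) hwρ.le).2]
  exact ⟨W, h1, h2, h3, fun w hw =>
    (point_neg_one_eq h he hR (h4 w hw).1 (hb (h4 w hw).2.1) (h4 w hw).2.2.le).1, h5⟩

end LipschitzSpray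

/-! ### Assembly of the theorem -/

theorem theorem3 {n : ℕ} {M : Type*} [TopologicalSpace M] [T2Space M]
    [ChartedSpace (EuclideanSpace ℝ (Fin n)) M] [IsC21Manifold n M]
    (S : LipschitzSpray n M) (p : M) (O : Set M) (hO : IsOpen O) (hp : p ∈ O) :
    (∃ C : Set M, p ∈ C ∧ C ⊆ O ∧ S.IsReversibleStrictlyConvexNormal C ∧
      S.ExpIsLipeo C ∧ S.RevExpIsLipeo C) ∧
    ∀ e ∈ c21Charts n M, p ∈ e.source →
      ∃ δ₀ : ℝ, 0 < δ₀ ∧ ∀ δ : ℝ, 0 < δ → δ < δ₀ →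
        Metric.ball (e p) δ ⊆ e.target ∧
        e.symm '' Metric.ball (e p) δ ⊆ O ∧
        S.IsReversibleStrictlyConvexNormal (e.symm '' Metric.ball (e p) δ) ∧
        S.ExpIsLipeo (e.symm '' Metric.ball (e p) δ) ∧
        S.RevExpIsLipeo (e.symm '' Metric.ball (e p) δ) := by
  have main : ∀ e ∈ c21Charts n M, p ∈ e.source →
      ∃ δ₀ : ℝ, 0 < δ₀ ∧ ∀ δ : ℝ, 0 < δ → δ < δ₀ →
        Metric.ball (e p) δ ⊆ e.target ∧
        e.symm '' Metric.ball (e p) δ ⊆ O ∧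
        S.IsReversibleStrictlyConvexNormal (e.symm '' Metric.ball (e p) δ) ∧
        S.ExpIsLipeo (e.symm '' Metric.ball (e p) δ) ∧
        S.RevExpIsLipeo (e.symm '' Metric.ball (e p) δ) := by
    intro e he hpe
    have hU : e.symm ⁻¹' O ∈ 𝓝 (e p) :=
      e.symm.continuousAt (e.map_source hpe) (by rw [e.left_inv hpe]; exact hO.mem_nhds hp)
    obtain ⟨R, K, hR, hS⟩ := S.exists_isSprayOnBall he hpe hU
    have hRt := hR.trans inter_subset_right
    obtain ⟨ρ, δ₁, X, V, h⟩ := hS.exists_isExpFlow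
    -- The reverse spray has a flow of its own with its own constants; it yields both reverse strict
    -- convexity and `revExp`.
    obtain ⟨ρ', δ₂, X', V', h'⟩ := hS.reverse.exists_isExpFlow
    refine ⟨min δ₁ δ₂, lt_min h.radius_pos h'.radius_pos, fun δ _ hδ => ?_⟩
    have hδ₁ := hδ.trans_le (min_le_left _ _)
    have hδ₂ := hδ.trans_le (min_le_right _ _)
    have hsub := (Metric.ball_subset_ball (hδ₁.le.trans h.radius_lt.le)).trans hR
    exact ⟨hsub.trans inter_subset_right,
      image_subset_iff.2 (hsub.trans inter_subset_left),
      ⟨LipschitzSpray.isStrictlyConvexNormal_ball h he hRt hδ₁,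
        LipschitzSpray.isStrictlyConvexNormal_ball (S := S.reverse) h' he hRt hδ₂⟩,
      LipschitzSpray.expIsLipeo_ball h he hRt hδ₁,
      LipschitzSpray.revExpIsLipeo_ball h' he hRt hδ₂⟩
  refine ⟨?_, main⟩
  have hpe := mem_chart_source (EuclideanSpace ℝ (Fin n)) p
  obtain ⟨δ₀, hδ₀, hδ⟩ := main _ (chartAt_mem_c21Charts p) hpe
  obtain ⟨-, h⟩ := hδ (δ₀ / 2) (by positivity) (by linarith)
  refine ⟨_, ?_, h⟩
  exact ⟨_, Metric.mem_ball_self (by positivity), OpenPartialHomeomorph.left_inv _ hpe⟩
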